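/- **Setting.** There are $n$ jobs, numbered so that $r_1\le\dots\le r_n$; job $j$ has an integer release time $r_j$, an integer deadline $d_j>r_j$ and a volume $w_j>0$. A schedule on one processor chooses at each time $\tau$ a speed $s(\tau)\ge 0$ and at most one job to run; it is feasible if each job $j$ runs only within $[r_j,d_j)$ and $\int_{\{\tau:\ j\text{ runs at }\tau\}} s(\tau)\,d\tau\ge w_j$. Its energy is $\int s(\tau)^\alpha\,d\tau$, where $\alpha>1$. Let $\mathrm{OPT}$ be the least energy of a feasible schedule (the energy of the optimal offline algorithm YDS of Yao, Demers and Shenker). The number $n$, the volumes $w_j$ and real predictions $p_j<q_j$ of $r_j,d_j$ are known in advance; $r_j,d_j$ become known at time $r_j$. The prediction error is $$\eta=\max_j\max\Big\{\frac{|p_j-r_j|}{q_j-p_j},\frac{|q_j-d_j|}{q_j-p_j}\Big\}.$$ **Algorithm SwP$(\lambda,\mu)$**, for $0\le\lambda<1/2$ and $0\le\mu\le1$. Let $p'_j=\lfloor p_j+\lambda(q_j-p_j)\rfloor$ and $q'_j=\lceil q_j-\lambda(q_j-p_j)\rceil$, and let $S'$ be the YDS schedule (earliest deadline first, EDF) of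 the jobs with windows $[p'_j,q'_j)$ and volumes $w_j$. For $t\in\mathbb Z$ let $[t+a_t(j),t+b_t(j))$ be the possibly empty part of the slot $[t,t+1)$ in which $S'$ runs $j$. The left part of the slot is $[t,t+(1-\mu))$ and the right part is $[t+(1-\mu),t+1)$; the interval $[t+(1-\mu)a_t(j),\,t+(1-\mu)b_t(j))$ of the left part is reserved for $j$. Let $\ell(j)=\sum_{t\in[r_j,d_j)}(1-\mu)(b_t(j)-a_t(j))$ and $\delta_j=w_j/(d_j-r_j)$. When job $j$ arrives, let $V_t$ be the volume that jobs $1,\dots,j-1$ have put on the right part of slot $t$. Volumes $0\le y_j^t\le\delta_j$ of $j$ are put on the right parts of the slots $t\in[r_j,d_j)$, and the remaining volume $X_j=w_j-\sum_t y_j^t$ is processed in the intervals reserved for $j$ in these slots, at speed $X_j/\ell(j)$. The $y_j^t$ are such that for all integers $t\in[r_j,d_j)$ $$\frac{V_t}{\mu}\ge\frac{X_j}{\ell(j)}\ \text{ if } y_j^t=0,\qquad \frac{V_t+y_j^t}{\mu}=\frac{X_j}{\ell(j)}\ \text{ if } 0<y_j^t<\delta_j,\qquad \frac{V_t+y_j^t}{\mu}\le\frac{X_j}{\ell(j)}\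 \text{ if } y_j^t=\delta_j$$ (with denominators cleared, so that these conditions have a meaning also when $\mu=0$ or $\ell(j)=0$). The right part of each slot $t$ processes the volumes assigned to it in EDF order, at speed $\frac1\mu\sum_j y_j^t$. **Theorem.** Let $\alpha>1$, $0\le\lambda<1/2$ and $0\le\mu\le1$. For every instance SwP$(\lambda,\mu)$ has an output, and every output, with energy $\mathcal E$, satisfies: 1. (Feasibility) If $\mu>0$ or $\eta\le\lambda$, then the schedule is feasible. 2. (Robustness) If $\mu>0$, then, whatever the predictions are, $\mathcal E\le 2^{\alpha-1}\alpha^\alpha\left(\frac1\mu\right)^{\alpha-1}\mathrm{OPT}$. 3. (Consistency and smoothness) If $\mu<1$ and $\eta\le\lambda$, then $\mathcal E\le\left(\frac1{1-\mu}\right)^{\alpha-1}\left(\frac{2\eta+1}{1-2\lambda}\right)^{\alpha-1}\mathrm{OPT}$. Hence, if $0<\mu<1$ and $\eta\le\lambda$, the strict competitive ratio is at most $$\min\left\{\left(\frac1{1-\mu}\right)^{\alpha-1}\left(\frac{2\eta+1}{1-2\lambda}\right)^{\alpha-1},\ 2^{\alpha-1}\alpha^\alpha\left(\frac1\mu\right)^{\alpha-1}\right\}.$$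 -/

import Mathlib

open scoped ENNReal

noncomputable section

namespace SpeedScaling

/-- The data of `n` jobs with integer release times and deadlines and real processing volumes. -/
structure JobSet (n : ℕ) where
  release : Fin n → ℤ
  deadline : Fin n → ℤ
  volume : Fin n → ℝ

/-- A single-processor schedule: the speed at every time, and the job (if any) that is executed. -/
structure Schedule (n : ℕ) where
  speed : ℝ → ℝ
  job : ℝ → Option (Fin n)

/-- The energy `∫ s(t) ^ α dt` of a schedule. -/
def Schedule.energy {n : ℕ} (S : Schedule n) (α : ℝ) : ℝ≥0∞ :=
  ∫⁻ τ, ENNReal.ofReal (S.speed τ ^ α)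

/-- A schedule is feasible for `J` if every job runs only between its release time and its deadline
and receives there at least its whole processing volume. -/
structure Schedule.IsFeasible {n : ℕ} (S : Schedule n) (J : JobSet n) : Prop where
  measurable_speed : Measurable S.speed
  measurable_job : ∀ j, MeasurableSet {τ | S.job τ = some j}
  speed_nonneg : ∀ τ, 0 ≤ S.speed τ
  in_window : ∀ τ j, S.job τ = some j → (J.release j : ℝ) ≤ τ ∧ τ < (J.deadline j : ℝ)
  completed : ∀ j, ENNReal.ofReal (J.volume j) ≤
    ∫⁻ τ in {τ | S.job τ = some j}, ENNReal.ofReal (S.speed τ)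

/-- The offline optimum: the least energy of a feasible schedule. -/
def JobSet.optEnergy {n : ℕ} (J : JobSet n) (α : ℝ) : ℝ≥0∞ :=
  ⨅ (S : Schedule n) (_ : S.IsFeasible J), S.energy α

/-- Earliest-deadline-first priority, ties broken by the index. -/
def JobSet.Before {n : ℕ} (J : JobSet n) (i j : Fin n) : Prop :=
  J.deadline i < J.deadline j ∨ (J.deadline i = J.deadline j ∧ i < j)

/-! ### The YDS algorithm

Release times and deadlines are integers, so the speed is constant on each slot `[t, t + 1)`.
Instead of contracting the time already used, one keeps the set of busy slots. -/

/-- State of the YDS algorithm: jobs not yet treated, slots already used, speeds fixed so far. -/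
structure YDSState (n : ℕ) where
  pending : Finset (Fin n)
  busy : Finset ℤ
  speed : ℤ → ℝ

/-- The pending jobs whose remaining window lies in `[a, b)`. -/
def YDSState.inside {n : ℕ} (st : YDSState n) (J : JobSet n) (a b : ℤ) : Finset (Fin n) :=
  {j ∈ st.pending | Finset.Ico (J.release j) (J.deadline j) \ st.busy ⊆ Finset.Ico a b}

/-- The intensity of `[a, b)`: volume that must be done there per unit of free time. -/
def YDSState.intensity {n : ℕ} (st : YDSState n) (J : JobSet n) (a b : ℤ) : ℝ :=
  (∑ j ∈ st.inside J a b, J.volume j) / ((Finset.Ico a b \ st.busy).card : ℝ)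

/-- One round of YDS: take an interval from a release time to a deadline of maximum intensity,
run its free slots at this intensity, and remove the jobs inside. -/
def YDSState.step {n : ℕ} (J : JobSet n) (st : YDSState n) : YDSState n :=
  open Classical in
  if h : (st.pending ×ˢ st.pending).Nonempty then
    let c := (Finset.exists_max_image (st.pending ×ˢ st.pending)
      (fun e => st.intensity J (J.release e.1) (J.deadline e.2)) h).choose
    let a := J.release c.1
    let b := J.deadline c.2
    { pending := st.pending \ st.inside J a b
      busy := st.busy ∪ Finset.Ico a b
      speed := fun t => if t ∈ Finset.Ico a b \ st.busy then st.intensity J a b else st.speed t }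
  else st

/-- The YDS speed in slot `[t, t + 1)`. Every round removes a job, so `n` rounds suffice. -/
def JobSet.ydsSpeed {n : ℕ} (J : JobSet n) (t : ℤ) : ℝ :=
  ((YDSState.step J)^[n] ⟨Finset.univ, ∅, fun _ => 0⟩).speed t

/-- The volume of `j` available in slot `t` if `rem` is the vector of unfinished volumes. -/
def JobSet.backlog {n : ℕ} (J : JobSet n) (rem : Fin n → ℝ) (t : ℤ) (j : Fin n) : ℝ :=
  if J.release j ≤ t then rem j else 0

/-- EDF in a slot `t` of capacity `cap`: the volume processed in the slot before `j` starts. -/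
def JobSet.edfStart {n : ℕ} (J : JobSet n) (cap : ℝ) (rem : Fin n → ℝ) (t : ℤ) (j : Fin n) : ℝ :=
  open Classical in
  min cap (∑ i with J.Before i j, J.backlog rem t i)

/-- EDF in a slot `t` of capacity `cap`: the volume processed in the slot when `j` stops. -/
def JobSet.edfStop {n : ℕ} (J : JobSet n) (cap : ℝ) (rem : Fin n → ℝ) (t : ℤ) (j : Fin n) : ℝ :=
  open Classical in
  min cap ((∑ i with J.Before i j, J.backlog rem t i) + J.backlog rem t j)

/-- The earliest release time. -/
def JobSet.start {n : ℕ} (J : JobSet n) : ℤ := ⨅ j, J.release j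

/-- Unfinished volumes in the YDS schedule (EDF with the YDS speeds) `k` slots after the start. -/
def JobSet.ydsRemaining {n : ℕ} (J : JobSet n) : ℕ → Fin n → ℝ
  | 0, j => J.volume j
  | k + 1, j =>
    let t := J.start + k
    J.ydsRemaining k j - (J.edfStop (J.ydsSpeed t) (J.ydsRemaining k) t j
      - J.edfStart (J.ydsSpeed t) (J.ydsRemaining k) t j)

/-- In the YDS schedule, job `j` is executed in slot `t` exactly during
`[t + ydsLo t j, t + ydsHi t j)`. -/
def JobSet.ydsLo {n : ℕ} (J : JobSet n) (t : ℤ) (j : Fin n) : ℝ :=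
  J.edfStart (J.ydsSpeed t) (J.ydsRemaining (t - J.start).toNat) t j / J.ydsSpeed t

/-- See `ydsLo`. -/
def JobSet.ydsHi {n : ℕ} (J : JobSet n) (t : ℤ) (j : Fin n) : ℝ :=
  J.edfStop (J.ydsSpeed t) (J.ydsRemaining (t - J.start).toNat) t j / J.ydsSpeed t

/-! ### Instances with predictions -/

/-- An instance with predicted release times and deadlines; jobs are numbered in the order in
which they arrive. -/
structure Instance (n : ℕ) extends JobSet n where
  predRelease : Fin n → ℝ
  predDeadline : Fin n → ℝ
  release_lt_deadline : ∀ j, release j < deadline j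
  volume_pos : ∀ j, 0 < volume j
  release_mono : Monotone release
  pred_lt : ∀ j, predRelease j < predDeadline j

/-- The max-norm error of the predictions. -/
def Instance.predError {n : ℕ} (I : Instance n) : ℝ :=
  ⨆ j, max (|I.predRelease j - I.release j| / (I.predDeadline j - I.predRelease j))
    (|I.predDeadline j - I.deadline j| / (I.predDeadline j - I.predRelease j))

/-- The instance given by the predictions, every interval being shrunk according to `lam`. -/
def Instance.shrunk {n : ℕ} (I : Instance n) (lam : ℝ) : JobSet n where
  release j := ⌊I.predRelease j + lam * (I.predDeadline j - I.predRelease j)⌋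
  deadline j := ⌈I.predDeadline j - lam * (I.predDeadline j - I.predRelease j)⌉
  volume := I.volume

/-! ### The algorithm SwP

Slot `[t, t + 1)` has the left part `[t, t + (1 - μ))` and the right part `[t + (1 - μ), t + 1)`. -/

/-- The density of a job. -/
def Instance.density {n : ℕ} (I : Instance n) (j : Fin n) : ℝ :=
  I.volume j / ((I.deadline j : ℝ) - (I.release j : ℝ))

/-- The time reserved for `j` on the left parts of the slots in which `j` may be run: the YDS
schedule of the shrunk predicted instance, compressed into the left parts. -/
def Instance.reserved {n : ℕ} (I : Instance n) (lam μ : ℝ) (j : Fin n) : ℝ :=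
  ∑ t ∈ Finset.Ico (I.release j) (I.deadline j),
    ((1 - μ) * (I.shrunk lam).ydsHi t j - (1 - μ) * (I.shrunk lam).ydsLo t j)

/-- The volume that the jobs before `j` put on the right part of slot `t`. -/
def rightLoad {n : ℕ} (y : Fin n → ℤ → ℝ) (t : ℤ) (j : Fin n) : ℝ :=
  ∑ i with i < j, y i t

/-- The volume of `j` that remains for the left parts. -/
def Instance.leftVolume {n : ℕ} (I : Instance n) (y : Fin n → ℤ → ℝ) (j : Fin n) : ℝ :=
  I.volume j - ∑ t ∈ Finset.Ico (I.release j) (I.deadline j), y j t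

/-- `y j t` is the volume of `j` that SwP puts on the right part of slot `t`. The three conditions
compare the speed `(V_t + y_t) / μ` of the right part with the speed `X / ℓ` of the left parts of
`j`; denominators are cleared, so that `ℓ = 0` (no time reserved) reads as `X / ℓ = ∞`. -/
structure Instance.IsSwPAssignment {n : ℕ} (I : Instance n) (lam μ : ℝ) (y : Fin n → ℤ → ℝ) :
    Prop where
  outside : ∀ j, ∀ t ∉ Finset.Ico (I.release j) (I.deadline j), y j t = 0
  nonneg : ∀ j, ∀ t ∈ Finset.Ico (I.release j) (I.deadline j), 0 ≤ y j t
  le_density : ∀ j, ∀ t ∈ Finset.Ico (I.release j) (I.deadline j), y j t ≤ I.density j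
  empty : ∀ j, ∀ t ∈ Finset.Ico (I.release j) (I.deadline j), y j t = 0 →
    μ * I.leftVolume y j ≤ rightLoad y t j * I.reserved lam μ j
  between : ∀ j, ∀ t ∈ Finset.Ico (I.release j) (I.deadline j), 0 < y j t → y j t < I.density j →
    (rightLoad y t j + y j t) * I.reserved lam μ j = μ * I.leftVolume y j
  full : ∀ j, ∀ t ∈ Finset.Ico (I.release j) (I.deadline j), y j t = I.density j →
    (rightLoad y t j + y j t) * I.reserved lam μ j ≤ μ * I.leftVolume y j

/-- The speed in the right part of slot `t`; only jobs released by time `t` contribute. -/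
def Instance.rightSpeed {n : ℕ} (I : Instance n) (μ : ℝ) (y : Fin n → ℤ → ℝ) (t : ℤ) : ℝ :=
  (∑ i with I.release i ≤ t, y i t) / μ

/-- SwP runs `j` at time `τ`: either in the interval reserved for `j` in the left part of the slot,
or in the right part, where the volumes `y · t` are processed by EDF. -/
def Instance.SwPRuns {n : ℕ} (I : Instance n) (lam μ : ℝ) (y : Fin n → ℤ → ℝ) (j : Fin n)
    (τ : ℝ) : Prop :=
  open Classical in
  (I.release j ≤ ⌊τ⌋ ∧ ⌊τ⌋ < I.deadline j ∧ Int.fract τ < 1 - μ ∧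
    (1 - μ) * (I.shrunk lam).ydsLo ⌊τ⌋ j ≤ Int.fract τ ∧
    Int.fract τ < (1 - μ) * (I.shrunk lam).ydsHi ⌊τ⌋ j) ∨
  (1 - μ ≤ Int.fract τ ∧
    (∑ i with I.Before i j, y i ⌊τ⌋) ≤ I.rightSpeed μ y ⌊τ⌋ * (Int.fract τ - (1 - μ)) ∧
    I.rightSpeed μ y ⌊τ⌋ * (Int.fract τ - (1 - μ)) <
      (∑ i with I.Before i j, y i ⌊τ⌋) + y j ⌊τ⌋)

/-- The job that SwP runs at time `τ`. -/
def Instance.swpJob {n : ℕ} (I : Instance n) (lam μ : ℝ) (y : Fin n → ℤ → ℝ) (τ : ℝ) :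
    Option (Fin n) :=
  open Classical in
  if h : ∃ j, I.SwPRuns lam μ y j τ then some h.choose else none

/-- The schedule that SwP builds from the volumes `y`. -/
def Instance.swpSchedule {n : ℕ} (I : Instance n) (lam μ : ℝ) (y : Fin n → ℤ → ℝ) :
    Schedule n where
  job := I.swpJob lam μ y
  speed τ :=
    match I.swpJob lam μ y τ with
    | none => 0
    | some j =>
      if Int.fract τ < 1 - μ then I.leftVolume y j / I.reserved lam μ j
      else I.rightSpeed μ y ⌊τ⌋

/-- `S` is an output of SwP with confidence parameters `lam` and `μ` on the instance `I`. -/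
def Instance.IsSwPSchedule {n : ℕ} (I : Instance n) (lam μ : ℝ) (S : Schedule n) : Prop :=
  ∃ y, I.IsSwPAssignment lam μ y ∧ S = I.swpSchedule lam μ y

end SpeedScaling

end

namespace SpeedScaling

/-! Both energy bounds rest on weak duality against an arbitrary feasible schedule
(`Schedule.IsFeasible.le_energy`). Give the jobs weights $c_j\ge 0$ and the slots weights $m_t\ge
c_j$ for every $t$ in the window of $j$. With $1/\alpha+1/p=1$, Hölder gives $E:=\sum_j
w_jc_j\le\int s\,m\le(\int s^\alpha)^{1/\alpha}(\sum_t m_t^p)^{1/p}$. If moreover $\sum_t m_t^p\le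
KE$, then $E\le K^{\alpha-1}\int s^\alpha$. What remains is to find weights for which $E$ is the
energy of a reference algorithm.

For the average rate heuristic (AVR) with speeds $A_t$, $c_j$ is the average of $A^{\alpha-1}$ over
the window of $j$, and $m$ is a two-sided maximal function of $A^{\alpha-1}$. The sharp one-sided
maximal inequality, derived from the rising sun lemma, gives $K=2\alpha^p$, whence
$K^{\alpha-1}=2^{\alpha-1}\alpha^\alpha$ (`JobSet.avr_le_energy`).

For YDS on the shrunk predicted windows, $c_j=v_j^{\alpha-1}$ with $v_j$ the speed at which YDS
fixes $j$, and $m_t$ is the largest $c_j$ over the true windows containing $t$. True windows lie in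
dilations of the shrunk ones, and dilation by $1+2k$ enlarges the measure of a union of intervals at
most by that factor. Comparing superlevel sets gives $K=1+2k=(2\eta+1)/(1-2\lambda)$
(`JobSet.yds_le_energy`).

The conditions on the volumes $y_j^t$ are first-order optimality conditions for splitting job $j$
between left and right parts at convex cost. Hence, job by job, the increase in cost is at most that
of putting everything on the right (`cost_le_right`) or everything on the left (`cost_le_left`). The
first option leads to AVR compressed into parts of length $\mu$, the second, by Jensen, to YDS
compressed into parts of length $1-\mu$.

Two facts about YDS are proved from its definition: the round intensities do not increase, so that
every job's speed $v_j$ is at most the slot speed throughout its window, and EDF at the YDS speeds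
finishes every job by its deadline. -/

/-- Every job has a nonempty window and a positive volume. -/
structure JobSet.Valid {n : ℕ} (J : JobSet n) : Prop where
  lt : ∀ j, J.release j < J.deadline j
  pos : ∀ j, 0 < J.volume j

/-! ### The rounds of YDS and the speeds they fix. -/

namespace YDSState

variable {n : ℕ}

/-- No interval has an intensity greater than `u`. -/
def IntensityLE (st : YDSState n) (J : JobSet n) (u : ℝ) : Prop :=
  ∀ a b : ℤ, ∑ j ∈ st.inside J a b, J.volume j ≤ u * ((Finset.Ico a b \ st.busy).card : ℝ)

/-- Every pending job still has a free slot in its window. -/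
def Live (st : YDSState n) (J : JobSet n) : Prop :=
  ∀ j ∈ st.pending, (Finset.Ico (J.release j) (J.deadline j) \ st.busy).Nonempty

/-- The state after running the free slots of `[a, b)` at speed `v`. -/
noncomputable def commit (st : YDSState n) (J : JobSet n) (a b : ℤ) (v : ℝ) : YDSState n where
  pending := st.pending \ st.inside J a b
  busy := st.busy ∪ Finset.Ico a b
  speed := fun t => if t ∈ Finset.Ico a b \ st.busy then v else st.speed t

lemma mem_inside {st : YDSState n} {J : JobSet n} {a b : ℤ} {j : Fin n} :
    j ∈ st.inside J a b ↔
      j ∈ st.pending ∧ Finset.Ico (J.release j) (J.deadline j) \ st.busy ⊆ Finset.Ico a b := by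
  simp [inside]

lemma mem_of_mem_inside {st : YDSState n} {J : JobSet n} {a b : ℤ} {j : Fin n}
    (h : j ∈ st.inside J a b) {t : ℤ} (h1 : J.release j ≤ t) (h2 : t < J.deadline j)
    (h3 : t ∉ st.busy) : a ≤ t ∧ t < b := by
  have := (mem_inside.1 h).2 (Finset.mem_sdiff.2 ⟨Finset.mem_Ico.2 ⟨h1, h2⟩, h3⟩)
  exact Finset.mem_Ico.1 this

/-- Replacing $[a,b)$ by the hull from the earliest release to the latest deadline of the jobs
inside loses no job and gains no free slot: each of the two extremal jobs has a free slot,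
necessarily in $[a,b)$, and windows are intervals. So it suffices to maximize over the finitely many
pairs that a round examines. -/
lemma intensityLE_of_endpoints {st : YDSState n} {J : JobSet n} (hJ : J.Valid) (hl : st.Live J)
    {u : ℝ} (hu : 0 ≤ u)
    (h : ∀ i ∈ st.pending, ∀ j ∈ st.pending,
      st.intensity J (J.release i) (J.deadline j) ≤ u) : st.IntensityLE J u := by
  intro a b
  rcases (st.inside J a b).eq_empty_or_nonempty with he | hne
  · rw [he, Finset.sum_empty]; exact mul_nonneg (by assumption) (Nat.cast_nonneg _)
  obtain ⟨i, hi, hi'⟩ := Finset.exists_min_image _ J.release hne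
  obtain ⟨j, hj, hj'⟩ := Finset.exists_max_image _ J.deadline hne
  have hip := (mem_inside.1 hi).1
  have hjp := (mem_inside.1 hj).1
  have hsub : Finset.Ico (J.release i) (J.deadline j) \ st.busy ⊆ Finset.Ico a b \ st.busy := by
    intro t ht
    simp only [Finset.mem_sdiff, Finset.mem_Ico] at ht ⊢
    obtain ⟨x, hx⟩ := hl i hip
    obtain ⟨y, hy⟩ := hl j hjp
    simp only [Finset.mem_sdiff, Finset.mem_Ico] at hx hy
    have hx' := mem_of_mem_inside hi hx.1.1 hx.1.2 hx.2
    have hy' := mem_of_mem_inside hj hy.1.1 hy.1.2 hy.2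
    refine ⟨⟨?_, ?_⟩, ht.2⟩
    · by_contra hc
      have := mem_of_mem_inside hi ht.1.1 (by omega) ht.2
      omega
    · by_contra hc
      have := mem_of_mem_inside hj (by omega) ht.1.2 ht.2
      omega
  have hins : st.inside J a b ⊆ st.inside J (J.release i) (J.deadline j) := by
    intro k hk
    refine mem_inside.2 ⟨(mem_inside.1 hk).1, fun t ht => ?_⟩
    simp only [Finset.mem_sdiff, Finset.mem_Ico] at ht ⊢
    have := hi' k hk
    have := hj' k hk
    omega
  have hcard : 0 < (Finset.Ico (J.release i) (J.deadline j) \ st.busy).card := by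
    obtain ⟨x, hx⟩ := hl i hip
    refine Finset.card_pos.2 ⟨x, ?_⟩
    simp only [Finset.mem_sdiff, Finset.mem_Ico] at hx ⊢
    have := hj' i hi
    exact ⟨⟨hx.1.1, by omega⟩, hx.2⟩
  have h1 := h i hip j hjp
  rw [intensity, div_le_iff₀ (by exact_mod_cast hcard)] at h1
  calc ∑ j ∈ st.inside J a b, J.volume j
      ≤ ∑ j ∈ st.inside J (J.release i) (J.deadline j), J.volume j :=
        Finset.sum_le_sum_of_subset_of_nonneg hins fun k _ _ => (hJ.pos k).le
    _ ≤ _ := h1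
    _ ≤ _ := by gcongr

lemma step_eq_commit {st : YDSState n} {J : JobSet n} (hJ : J.Valid) (hl : st.Live J)
    (hne : st.pending.Nonempty) :
    ∃ a b v, step J st = st.commit J a b v ∧ 0 < v ∧
      ∑ j ∈ st.inside J a b, J.volume j = v * ((Finset.Ico a b \ st.busy).card : ℝ) ∧
      st.IntensityLE J v ∧ (st.inside J a b).Nonempty := by
  classical
  have h : (st.pending ×ˢ st.pending).Nonempty := hne.product hne
  have hspec := (Finset.exists_max_image (st.pending ×ˢ st.pending)
      (fun e => st.intensity J (J.release e.1) (J.deadline e.2)) h).choose_spec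
  set c := (Finset.exists_max_image (st.pending ×ˢ st.pending)
      (fun e => st.intensity J (J.release e.1) (J.deadline e.2)) h).choose with hc
  obtain ⟨hcm, hmax⟩ := hspec
  have hpos : 0 < st.intensity J (J.release c.1) (J.deadline c.2) := by
    obtain ⟨i, hi⟩ := hne
    refine lt_of_lt_of_le ?_ (hmax (i, i) (Finset.mem_product.2 ⟨hi, hi⟩))
    refine div_pos ?_ (by exact_mod_cast Finset.card_pos.2 (hl i hi))
    exact Finset.sum_pos (fun k _ => hJ.pos k)
      ⟨i, mem_inside.2 ⟨hi, Finset.sdiff_subset⟩⟩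
  refine ⟨J.release c.1, J.deadline c.2, _, ?_, hpos, ?_, ?_, ?_⟩
  · rw [step, dif_pos h]; rfl
  · have hcard : ((Finset.Ico (J.release c.1) (J.deadline c.2) \ st.busy).card : ℝ) ≠ 0 := by
      intro h0
      rw [intensity, h0, div_zero] at hpos
      exact lt_irrefl _ hpos
    rw [intensity, div_mul_cancel₀ _ hcard]
  · refine intensityLE_of_endpoints hJ hl hpos.le fun i hi j hj => ?_
    exact hmax (i, j) (Finset.mem_product.2 ⟨hi, hj⟩)
  · by_contra hemp
    rw [Finset.not_nonempty_iff_eq_empty] at hemp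
    rw [intensity, hemp, Finset.sum_empty, zero_div] at hpos
    exact lt_irrefl _ hpos

lemma live_commit {st : YDSState n} {J : JobSet n} {a b : ℤ} {v : ℝ} :
    (st.commit J a b v).Live J := by
  intro j hj
  simp only [commit, Finset.mem_sdiff, mem_inside, not_and] at hj
  obtain ⟨t, ht, ht'⟩ := Finset.not_subset.1 (hj.2 hj.1)
  refine ⟨t, ?_⟩
  simp only [commit, Finset.mem_sdiff, Finset.mem_union, not_or] at ht ⊢
  exact ⟨ht.1, ht.2, ht'⟩

/-- This is the monotonicity of the intensities. If no free slot separates $[a,b)$ from $[A,B)$, the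
hull of both contains the jobs inside either, and its free slots are exactly those of the two.
Subtracting the tight equation for $[A,B)$ from the bound for the hull leaves the bound for $[a,b)$.
If a free slot lies between them, the remaining jobs were inside $[a,b)$ already. -/
lemma intensityLE_commit {st : YDSState n} {J : JobSet n} {A B : ℤ} {v : ℝ} (hv : 0 ≤ v)
    (hb : st.IntensityLE J v)
    (htight : ∑ j ∈ st.inside J A B, J.volume j = v * ((Finset.Ico A B \ st.busy).card : ℝ))
    (hJ : J.Valid) : (st.commit J A B v).IntensityLE J v := by
  intro a b
  set st' := st.commit J A B v with hst'
  have hp : ∀ j ∈ st'.inside J a b, j ∈ st.pending ∧ j ∉ st.inside J A B := by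
    intro j hj
    have := (mem_inside.1 hj).1
    simpa [hst', commit] using this
  have hcov : ∀ j ∈ st'.inside J a b, ∀ t, J.release j ≤ t → t < J.deadline j → t ∉ st.busy →
      (A ≤ t ∧ t < B) ∨ (a ≤ t ∧ t < b) := by
    intro j hj t h1 h2 h3
    by_cases h : A ≤ t ∧ t < B
    · exact Or.inl h
    · refine Or.inr (mem_of_mem_inside hj h1 h2 ?_)
      simp only [hst', commit, Finset.mem_union, Finset.mem_Ico, not_or]
      exact ⟨h3, h⟩
  have hfree : ∀ j ∈ st'.inside J a b, ∃ t, J.release j ≤ t ∧ t < J.deadline j ∧ t ∉ st.busy ∧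
      ¬ (A ≤ t ∧ t < B) ∧ (a ≤ t ∧ t < b) := by
    intro j hj
    obtain ⟨h1, h2⟩ := hp j hj
    rw [mem_inside, not_and] at h2
    obtain ⟨t, ht, ht'⟩ := Finset.not_subset.1 (h2 h1)
    simp only [Finset.mem_sdiff, Finset.mem_Ico] at ht ht'
    exact ⟨t, ht.1.1, ht.1.2, ht.2, ht', (hcov j hj t ht.1.1 ht.1.2 ht.2).resolve_left ht'⟩
  rcases (st'.inside J a b).eq_empty_or_nonempty with he | ⟨j₀, hj₀⟩
  · rw [he, Finset.sum_empty]; exact mul_nonneg (by assumption) (Nat.cast_nonneg _)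
  obtain ⟨x₀, -, -, -, -, hx₀⟩ := hfree j₀ hj₀
  -- A remaining job inside $[a,b)$ has a free slot in $[a,b)$ outside $[A,B)$. Were its window to
  -- reach a free slot that is not in $[a,b)$, it would contain `g`, contrary to `hcov`.
  by_cases hgap : ∃ g, g ∉ st.busy ∧ ((b ≤ g ∧ g < A) ∨ (B ≤ g ∧ g < a))
  · obtain ⟨g, hg, hgap⟩ := hgap
    have hsub : st'.inside J a b ⊆ st.inside J a b := by
      intro j hj
      refine mem_inside.2 ⟨(hp j hj).1, fun t ht => ?_⟩
      simp only [Finset.mem_sdiff, Finset.mem_Ico] at ht ⊢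
      obtain ⟨x, hx1, hx2, hx3, hx4, hx5⟩ := hfree j hj
      by_contra hc
      have h1 := (hcov j hj t ht.1.1 ht.1.2 ht.2).resolve_right hc
      have h2 := hcov j hj g (by omega) (by omega) hg
      omega
    calc ∑ j ∈ st'.inside J a b, J.volume j ≤ ∑ j ∈ st.inside J a b, J.volume j :=
          Finset.sum_le_sum_of_subset_of_nonneg hsub fun k _ _ => (hJ.pos k).le
      _ ≤ v * ((Finset.Ico a b \ st.busy).card : ℝ) := hb a b
      _ ≤ _ := by
        refine mul_le_mul_of_nonneg_left (Nat.cast_le.2 (Finset.card_le_card fun t ht => ?_)) hv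
        simp only [hst', commit, Finset.mem_sdiff, Finset.mem_Ico, Finset.mem_union,
          not_or] at ht ⊢
        refine ⟨ht.1, ht.2, ?_⟩
        omega
  · by_cases hAB : A < B
    swap
    · have hemp : Finset.Ico A B = ∅ := Finset.Ico_eq_empty hAB
      have hsub : st'.inside J a b ⊆ st.inside J a b := by
        intro j hj
        refine mem_inside.2 ⟨(hp j hj).1, ?_⟩
        have := (mem_inside.1 hj).2
        simpa [hst', commit, hemp] using this
      calc ∑ j ∈ st'.inside J a b, J.volume j ≤ ∑ j ∈ st.inside J a b, J.volume j :=
            Finset.sum_le_sum_of_subset_of_nonneg hsub fun k _ _ => (hJ.pos k).le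
        _ ≤ v * ((Finset.Ico a b \ st.busy).card : ℝ) := hb a b
        _ = _ := by simp [hst', commit, hemp]
    have hunion : st'.inside J a b ∪ st.inside J A B ⊆ st.inside J (min a A) (max b B) := by
      intro j hj
      rcases Finset.mem_union.1 hj with hj | hj
      · refine mem_inside.2 ⟨(hp j hj).1, fun t ht => ?_⟩
        simp only [Finset.mem_sdiff, Finset.mem_Ico] at ht ⊢
        have := hcov j hj t ht.1.1 ht.1.2 ht.2
        omega
      · refine mem_inside.2 ⟨(mem_inside.1 hj).1, fun t ht => ?_⟩
        simp only [Finset.mem_sdiff, Finset.mem_Ico] at ht ⊢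
        have := mem_of_mem_inside hj ht.1.1 ht.1.2 ht.2
        omega
    have hdisj : Disjoint (st'.inside J a b) (st.inside J A B) :=
      Finset.disjoint_left.2 fun j hj => (hp j hj).2
    have hcard : (Finset.Ico (min a A) (max b B) \ st.busy).card =
        (Finset.Ico a b \ st'.busy).card + (Finset.Ico A B \ st.busy).card := by
      rw [← Finset.card_union_of_disjoint]
      · congr 1
        ext t
        simp only [hst', commit, Finset.mem_sdiff, Finset.mem_Ico, Finset.mem_union, not_or]
        constructor
        · rintro ⟨h1, h2⟩
          by_cases h3 : A ≤ t ∧ t < B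
          · exact Or.inr ⟨h3, h2⟩
          · refine Or.inl ⟨?_, h2, h3⟩
            by_contra h4
            exact hgap ⟨t, h2, by omega⟩
        · rintro (⟨h1, h2, h3⟩ | ⟨h1, h2⟩)
          · exact ⟨by omega, h2⟩
          · exact ⟨by omega, h2⟩
      · rw [Finset.disjoint_left]
        intro t ht ht'
        simp only [hst', commit, Finset.mem_sdiff, Finset.mem_Ico, Finset.mem_union,
          not_or] at ht ht'
        exact ht.2.2 ht'.1
    have h1 := hb (min a A) (max b B)
    have h2 : ∑ j ∈ st'.inside J a b ∪ st.inside J A B, J.volume j ≤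
        ∑ j ∈ st.inside J (min a A) (max b B), J.volume j :=
      Finset.sum_le_sum_of_subset_of_nonneg hunion fun k _ _ => (hJ.pos k).le
    rw [Finset.sum_union hdisj, htight] at h2
    rw [hcard] at h1
    push_cast at h1
    nlinarith

/-- What the remaining rounds of YDS do from the state `st`: `v` is the speed of the pending jobs
and `C` the set of slots which are still going to be used. -/
structure RunSpec (st : YDSState n) (J : JobSet n) (f : ℤ → ℝ) (v : Fin n → ℝ)
    (C : Finset ℤ) : Prop where
  frozen : ∀ t ∈ st.busy, f t = st.speed t
  disjoint : Disjoint C st.busy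
  pos : ∀ t ∈ C, 0 < f t
  eq_zero : ∀ t ∉ st.busy, t ∉ C → f t = 0
  pos_job : ∀ j ∈ st.pending, 0 < v j
  le_speed : ∀ j ∈ st.pending, ∀ t ∈ Finset.Ico (J.release j) (J.deadline j) \ st.busy, v j ≤ f t
  le_intensity : ∀ u, st.IntensityLE J u → ∀ j ∈ st.pending, v j ≤ u
  balance : ∀ β : ℝ, ∑ j ∈ st.pending, J.volume j * v j ^ β = ∑ t ∈ C, f t * f t ^ β
  capacity : ∀ a b, ∑ j ∈ st.inside J a b, J.volume j ≤ ∑ t ∈ Finset.Ico a b \ st.busy, f t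

lemma step_of_pending_eq_empty {st : YDSState n} {J : JobSet n} (h : st.pending = ∅) :
    step J st = st := by
  rw [step, dif_neg]
  simp [h]

/-- The inductive step, backwards in time: the round just made is put before the rounds already
described. Its jobs get the speed $u$, and its free slots keep that speed for ever because they are
now busy. -/
lemma RunSpec.of_commit {st : YDSState n} {J : JobSet n} {a b : ℤ} {u : ℝ} {f : ℤ → ℝ}
    {v : Fin n → ℝ} {C : Finset ℤ} (h : (st.commit J a b u).RunSpec J f v C) (hJ : J.Valid)
    (hu : 0 < u)
    (htight : ∑ j ∈ st.inside J a b, J.volume j = u * ((Finset.Ico a b \ st.busy).card : ℝ))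
    (hb : st.IntensityLE J u) (hne : (st.inside J a b).Nonempty) (hl : st.Live J) :
    st.RunSpec J f (fun j => if j ∈ st.inside J a b then u else v j)
      (C ∪ (Finset.Ico a b \ st.busy)) := by
  have hfab : ∀ t ∈ Finset.Ico a b \ st.busy, f t = u := by
    intro t ht
    rw [h.frozen t (by
      simp only [commit, Finset.mem_union]
      exact Or.inr (Finset.mem_sdiff.1 ht).1)]
    simp only [commit, if_pos ht]
  have hCd : Disjoint C (Finset.Ico a b \ st.busy) :=
    h.disjoint.mono_right (Finset.sdiff_subset.trans Finset.subset_union_right)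
  have hpend : ∀ j ∈ st.pending, j ∉ st.inside J a b → j ∈ (st.commit J a b u).pending :=
    fun j h1 h2 => Finset.mem_sdiff.2 ⟨h1, h2⟩
  -- A job left for later may still have free slots of this round in its window. There `le_speed`
  -- needs its later speed to be at most $u$, which is why `le_intensity` is carried along for every
  -- upper bound of the intensities.
  have hvu : ∀ j ∈ (st.commit J a b u).pending, v j ≤ u :=
    h.le_intensity u (intensityLE_commit hu.le hb htight hJ)
  have hle : ∀ j ∈ st.pending, (if j ∈ st.inside J a b then u else v j) ≤ u := by
    intro j hj
    split_ifs with hj'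
    · exact le_rfl
    · exact hvu j (hpend j hj hj')
  have hminu : ∀ u', st.IntensityLE J u' → u ≤ u' := by
    intro u' hu'
    have h1 := hu' a b
    rw [htight] at h1
    have hpos : 0 < ((Finset.Ico a b \ st.busy).card : ℝ) := by
      obtain ⟨j, hj⟩ := hne
      obtain ⟨x, hx⟩ := hl j (mem_inside.1 hj).1
      have := Finset.card_pos.2 ⟨x, Finset.mem_sdiff.2
        ⟨(mem_inside.1 hj).2 hx, (Finset.mem_sdiff.1 hx).2⟩⟩
      exact_mod_cast this
    exact le_of_mul_le_mul_right h1 hpos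
  refine ⟨?_, ?_, ?_, ?_, ?_, ?_, ?_, ?_, ?_⟩
  · intro t ht
    rw [h.frozen t (Finset.mem_union_left _ ht)]
    simp [commit, ht]
  · refine Finset.disjoint_union_left.2 ⟨h.disjoint.mono_right Finset.subset_union_left, ?_⟩
    exact Finset.sdiff_disjoint
  · intro t ht
    rcases Finset.mem_union.1 ht with ht | ht
    · exact h.pos t ht
    · rw [hfab t ht]; exact hu
  · intro t ht ht'
    rw [Finset.mem_union, not_or, Finset.mem_sdiff] at ht'
    refine h.eq_zero t ?_ ht'.1
    simp only [commit, Finset.mem_union, not_or]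
    exact ⟨ht, fun hc => ht'.2 ⟨hc, ht⟩⟩
  · intro j hj
    show 0 < if j ∈ st.inside J a b then u else v j
    split_ifs with hj'
    · exact hu
    · exact h.pos_job j (hpend j hj hj')
  · intro j hj t ht
    by_cases htab : t ∈ Finset.Ico a b
    · rw [hfab t (Finset.mem_sdiff.2 ⟨htab, (Finset.mem_sdiff.1 ht).2⟩)]
      exact hle j hj
    · have hj' : j ∉ st.inside J a b := fun hc => htab ((mem_inside.1 hc).2 ht)
      simp only [if_neg hj']
      refine h.le_speed j (hpend j hj hj') t ?_
      simp only [commit, Finset.mem_sdiff, Finset.mem_union, not_or] at ht ⊢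
      exact ⟨ht.1, ht.2, htab⟩
  · intro u' hu' j hj
    exact (hle j hj).trans (hminu u' hu')
  · intro β
    rw [Finset.sum_union hCd, ← h.balance β,
      ← Finset.sum_sdiff (Finset.filter_subset _ _ : st.inside J a b ⊆ st.pending)]
    refine congrArg₂ (· + ·) ?_ ?_
    · refine Finset.sum_congr rfl fun j hj => ?_
      simp only [if_neg (Finset.mem_sdiff.1 hj).2]
    -- The speed is constant in a round, so the tight equation times $u^\beta$ is the contribution
    -- of this round.
    · have h1 : ∑ t ∈ Finset.Ico a b \ st.busy, f t * f t ^ β =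
          ∑ t ∈ Finset.Ico a b \ st.busy, u * u ^ β :=
        Finset.sum_congr rfl fun t ht => by rw [hfab t ht]
      rw [h1, Finset.sum_const, nsmul_eq_mul, ← mul_assoc, mul_comm (_ : ℝ) u, ← htight,
        Finset.sum_mul]
      exact Finset.sum_congr rfl fun j hj => by simp only [if_pos hj]
  · intro a' b'
    -- Jobs not treated in this round are covered by the later rounds. The treated ones lie in the
    -- intersection of the two intervals, whose intensity is at most $u$ while all its free slots
    -- run at $u$.
    have hdecomp : st.inside J a' b' =
        (st.inside J a' b' \ st.inside J a b) ∪ (st.inside J a' b' ∩ st.inside J a b) :=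
      (Finset.sdiff_union_inter _ _).symm
    have hd : Disjoint (st.inside J a' b' \ st.inside J a b)
        (st.inside J a' b' ∩ st.inside J a b) := Finset.disjoint_sdiff_inter _ _
    have hs1 : st.inside J a' b' \ st.inside J a b ⊆ (st.commit J a b u).inside J a' b' := by
      intro j hj
      obtain ⟨h1, h2⟩ := Finset.mem_sdiff.1 hj
      refine mem_inside.2 ⟨hpend j (mem_inside.1 h1).1 h2, fun t ht => (mem_inside.1 h1).2 ?_⟩
      exact Finset.sdiff_subset_sdiff (le_refl _) Finset.subset_union_left ht
    have hs2 : st.inside J a' b' ∩ st.inside J a b ⊆ st.inside J (max a a') (min b b') := by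
      intro j hj
      obtain ⟨h1, h2⟩ := Finset.mem_inter.1 hj
      refine mem_inside.2 ⟨(mem_inside.1 h1).1, fun t ht => ?_⟩
      have h3 := (mem_inside.1 h1).2 ht
      have h4 := (mem_inside.1 h2).2 ht
      simp only [Finset.mem_Ico] at h3 h4 ⊢
      omega
    have hsplit : Finset.Ico a' b' \ st.busy =
        (Finset.Ico a' b' \ (st.commit J a b u).busy) ∪
          (Finset.Ico (max a a') (min b b') \ st.busy) := by
      ext t
      simp only [commit, Finset.mem_sdiff, Finset.mem_union, Finset.mem_Ico, not_or]
      by_cases ht : t ∈ st.busy <;> simp only [ht, not_true, not_false_iff, and_false, and_true,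
        true_and, false_and, or_false]
      omega
    have hd' : Disjoint (Finset.Ico a' b' \ (st.commit J a b u).busy)
        (Finset.Ico (max a a') (min b b') \ st.busy) := by
      rw [Finset.disjoint_left]
      intro t ht ht'
      simp only [commit, Finset.mem_sdiff, Finset.mem_union, Finset.mem_Ico, not_or] at ht ht'
      omega
    rw [hdecomp, Finset.sum_union hd, hsplit, Finset.sum_union hd']
    refine add_le_add ?_ ?_
    · exact (Finset.sum_le_sum_of_subset_of_nonneg hs1 fun k _ _ => (hJ.pos k).le).trans
        (h.capacity a' b')
    · refine (Finset.sum_le_sum_of_subset_of_nonneg hs2 fun k _ _ => (hJ.pos k).le).trans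
        ((hb _ _).trans_eq ?_)
      rw [Finset.sum_congr rfl (g := fun _ => u), Finset.sum_const, nsmul_eq_mul, mul_comm]
      intro t ht
      refine hfab t ?_
      simp only [Finset.mem_sdiff, Finset.mem_Ico] at ht ⊢
      exact ⟨by omega, ht.2⟩

/-- Each round with pending jobs removes at least one of them, so the number of rounds serves as the
induction variable, with the starting state left arbitrary. -/
lemma exists_runSpec {J : JobSet n} (hJ : J.Valid) (k : ℕ) :
    ∀ st : YDSState n, st.Live J → (∀ t ∉ st.busy, st.speed t = 0) → st.pending.card ≤ k →
      ∃ v C, st.RunSpec J ((step J)^[k] st).speed v C := by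
  induction k with
  | zero =>
    intro st hl h0 hk
    have hp : st.pending = ∅ := Finset.card_eq_zero.1 (Nat.le_zero.1 hk)
    have hi : ∀ a b, st.inside J a b = ∅ := fun a b => by simp [inside, hp]
    refine ⟨fun _ => 0, ∅, ?_⟩
    constructor <;> simp [hp, hi]
    · exact h0
    · exact fun a b => Finset.sum_nonneg fun t ht => (h0 t (Finset.mem_sdiff.1 ht).2).ge
  | succ k ih =>
    intro st hl h0 hk
    rw [Function.iterate_succ_apply]
    rcases st.pending.eq_empty_or_nonempty with hp | hp
    · rw [step_of_pending_eq_empty hp]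
      exact ih st hl h0 (by simp [hp])
    · obtain ⟨a, b, u, hstep, hu, htight, hb, hne⟩ := step_eq_commit hJ hl hp
      rw [hstep]
      obtain ⟨v, C, hv⟩ := ih (st.commit J a b u) live_commit (by
          intro t ht
          simp only [commit, Finset.mem_union, not_or] at ht ⊢
          rw [if_neg (fun hc => ht.2 (Finset.mem_sdiff.1 hc).1)]
          exact h0 t ht.1) (by
          have : (st.commit J a b u).pending.card < st.pending.card :=
            Finset.card_lt_card (Finset.sdiff_ssubset (Finset.filter_subset _ _) hne)
          omega)
      exact ⟨_, _, hv.of_commit hJ hu htight hb hne hl⟩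

end YDSState

/-- The properties of the YDS speeds `s`: `v` gives the speed of every job and `C` the set of
slots in use. -/
structure JobSet.YDSSpec {n : ℕ} (J : JobSet n) (v : Fin n → ℝ) (C : Finset ℤ) : Prop where
  pos : ∀ t ∈ C, 0 < J.ydsSpeed t
  eq_zero : ∀ t ∉ C, J.ydsSpeed t = 0
  pos_job : ∀ j, 0 < v j
  le_speed : ∀ j, ∀ t ∈ Finset.Ico (J.release j) (J.deadline j), v j ≤ J.ydsSpeed t
  balance : ∀ β : ℝ, ∑ j, J.volume j * v j ^ β = ∑ t ∈ C, J.ydsSpeed t * J.ydsSpeed t ^ β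
  capacity : ∀ a b, ∑ j with a ≤ J.release j ∧ J.deadline j ≤ b, J.volume j ≤
    ∑ t ∈ Finset.Ico a b, J.ydsSpeed t

lemma JobSet.exists_ydsSpec {n : ℕ} {J : JobSet n} (hJ : J.Valid) : ∃ v C, J.YDSSpec v C := by
  obtain ⟨v, C, h⟩ := YDSState.exists_runSpec hJ n ⟨Finset.univ, ∅, fun _ => 0⟩
    (fun j _ => by simpa using hJ.lt j) (by simp) (by simp)
  refine ⟨v, C, h.pos, fun t ht => h.eq_zero t (by simp) ht, fun j => h.pos_job j (by simp),
    fun j t ht => h.le_speed j (by simp) t (by simpa using ht), h.balance, fun a b => ?_⟩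
  have := h.capacity a b
  rw [Finset.sdiff_empty] at this
  refine le_trans (Finset.sum_le_sum_of_subset_of_nonneg ?_ fun k _ _ => (hJ.pos k).le) this
  intro j hj
  simp only [Finset.mem_filter, Finset.mem_univ, true_and] at hj
  refine YDSState.mem_inside.2 ⟨Finset.mem_univ _, ?_⟩
  rw [Finset.sdiff_empty]
  exact Finset.Ico_subset_Ico hj.1 hj.2

/-- Adding the element of largest key leaves all earlier prefix sums unchanged. With `F = min cap`
this accounts for EDF work in a slot; with $F(x)=\mu(x/\mu)^\alpha$ it adds up the cost increments
of successive jobs. -/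
lemma sum_telescope_on {ι κ : Type*} [DecidableEq ι] [LinearOrder κ] (s : Finset ι) (key : ι → κ)
    (hkey : Function.Injective key) (b : ι → ℝ) (F : ℝ → ℝ) :
    ∑ j ∈ s, (F (∑ i ∈ s with key i < key j, b i + b j) - F (∑ i ∈ s with key i < key j, b i)) =
      F (∑ i ∈ s, b i) - F 0 := by
  induction s using Finset.induction_on_max_value key with
  | empty => simp
  | insert a s ha hmax ih =>
    have hlt : ∀ x ∈ s, key x < key a := fun x hx =>
      lt_of_le_of_ne (hmax x hx) fun h => ha (hkey h ▸ hx)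
    have h1 : (insert a s).filter (fun i => key i < key a) = s := by
      ext x
      simp only [Finset.mem_filter, Finset.mem_insert]
      refine ⟨?_, fun hx => ⟨Or.inr hx, hlt x hx⟩⟩
      rintro ⟨rfl | hx, h⟩
      · exact absurd h (lt_irrefl _)
      · exact hx
    have h2 : ∀ j ∈ s, (insert a s).filter (fun i => key i < key j) =
        s.filter (fun i => key i < key j) := by
      intro j hj
      rw [Finset.filter_insert, if_neg (not_lt.2 (hmax j hj))]
    have h3 : ∀ j ∈ s, F (∑ i ∈ insert a s with key i < key j, b i + b j) -
        F (∑ i ∈ insert a s with key i < key j, b i) =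
        F (∑ i ∈ s with key i < key j, b i + b j) - F (∑ i ∈ s with key i < key j, b i) :=
      fun j hj => by rw [h2 j hj]
    rw [Finset.sum_insert ha, h1, Finset.sum_insert ha, Finset.sum_congr rfl h3, ih,
      add_comm (b a)]
    ring

lemma sum_telescope {ι κ : Type*} [Fintype ι] [LinearOrder κ] (key : ι → κ)
    (hkey : Function.Injective key) (b : ι → ℝ) (F : ℝ → ℝ) :
    ∑ j, (F (∑ i with key i < key j, b i + b j) - F (∑ i with key i < key j, b i)) =
      F (∑ i, b i) - F 0 := by
  classical
  exact sum_telescope_on Finset.univ key hkey b F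

lemma min_add_sub_min_le {c x b : ℝ} (hb : 0 ≤ b) : min c (x + b) - min c x ≤ b := by
  rcases min_cases c x with h | h <;> rcases min_cases c (x + b) with h' | h' <;> linarith

/-! ### EDF at the YDS speeds completes every job in its window. -/

namespace JobSet

variable {n : ℕ} (J : JobSet n)

/-- The sort key of the earliest-deadline-first order. -/
def edfKey (j : Fin n) : ℤ ×ₗ Fin n := toLex (J.deadline j, j)

lemma edfKey_injective : Function.Injective J.edfKey := by
  intro i j h
  have := congrArg (fun p => (ofLex p).2) h
  simpa [edfKey] using this

lemma before_iff {i j : Fin n} : J.Before i j ↔ J.edfKey i < J.edfKey j := by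
  simp [Before, edfKey, Prod.Lex.toLex_lt_toLex]

lemma Before.trichotomy {i j : Fin n} (h : i ≠ j) : J.Before i j ∨ J.Before j i := by
  rw [before_iff, before_iff]
  exact lt_or_gt_of_ne fun hc => h (J.edfKey_injective hc)

/-- The jobs that EDF does not postpone for `j`. -/
noncomputable def upTo (j : Fin n) : Finset (Fin n) := by
  classical exact {i | J.edfKey i ≤ J.edfKey j}

lemma mem_upTo {i j : Fin n} : i ∈ J.upTo j ↔ J.edfKey i ≤ J.edfKey j := by
  simp [upTo]

lemma sum_before_add_le {b : Fin n → ℝ} (hb : ∀ i, 0 ≤ b i) {i j : Fin n} (h : J.Before i j) :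
    open Classical in
    (∑ k with J.Before k i, b k) + b i ≤ ∑ k with J.Before k j, b k := by
  classical
  rw [add_comm, ← Finset.sum_insert (by simp [before_iff])]
  refine Finset.sum_le_sum_of_subset_of_nonneg (fun k hk => ?_) fun k _ _ => hb k
  simp only [Finset.mem_insert, Finset.mem_filter, Finset.mem_univ, true_and] at hk ⊢
  rcases hk with rfl | hk
  · exact h
  · rw [before_iff] at *
    exact hk.trans h

variable {cap : ℝ} {rem : Fin n → ℝ} {t : ℤ}

lemma backlog_nonneg (hr : ∀ i, 0 ≤ rem i) (j : Fin n) : 0 ≤ J.backlog rem t j := by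
  unfold backlog; split_ifs <;> simp [hr]

lemma edfStart_nonneg (hc : 0 ≤ cap) (hr : ∀ i, 0 ≤ rem i) (j : Fin n) :
    0 ≤ J.edfStart cap rem t j :=
  le_min hc (Finset.sum_nonneg fun i _ => J.backlog_nonneg hr i)

lemma edfStart_le_edfStop (hr : ∀ i, 0 ≤ rem i) (j : Fin n) :
    J.edfStart cap rem t j ≤ J.edfStop cap rem t j :=
  min_le_min le_rfl (le_add_of_nonneg_right (J.backlog_nonneg hr j))

lemma edfStop_le (j : Fin n) : J.edfStop cap rem t j ≤ cap := min_le_left _ _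

lemma edfStop_le_edfStart (hr : ∀ i, 0 ≤ rem i) {i j : Fin n} (h : J.Before i j) :
    J.edfStop cap rem t i ≤ J.edfStart cap rem t j :=
  min_le_min le_rfl (J.sum_before_add_le (J.backlog_nonneg hr) h)

lemma edfStop_sub_le (hr : ∀ i, 0 ≤ rem i) (j : Fin n) :
    J.edfStop cap rem t j - J.edfStart cap rem t j ≤ J.backlog rem t j :=
  min_add_sub_min_le (J.backlog_nonneg hr j)

/-- The jobs up to `j` form an initial segment of the priority order, so lower priorities do not
disturb them and the sum telescopes. -/
lemma sum_upTo_processed (hc : 0 ≤ cap) (j : Fin n) :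
    ∑ i ∈ J.upTo j, (J.edfStop cap rem t i - J.edfStart cap rem t i) =
      min cap (∑ i ∈ J.upTo j, J.backlog rem t i) := by
  classical
  have h := sum_telescope_on (J.upTo j) J.edfKey J.edfKey_injective (J.backlog rem t) (min cap)
  rw [min_eq_right hc, sub_zero] at h
  rw [← h]
  refine Finset.sum_congr rfl fun i hi => ?_
  have hf : (J.upTo j).filter (fun k => J.edfKey k < J.edfKey i) =
      Finset.univ.filter (fun k => J.Before k i) := by
    ext k
    simp only [Finset.mem_filter, Finset.mem_univ, true_and, before_iff, mem_upTo]
    exact ⟨fun h => h.2, fun h => ⟨h.le.trans (J.mem_upTo.1 hi), h⟩⟩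
  unfold edfStop edfStart
  rw [hf]

lemma sum_processed_le (hc : 0 ≤ cap) :
    ∑ i, (J.edfStop cap rem t i - J.edfStart cap rem t i) ≤ cap := by
  classical
  have h := sum_telescope J.edfKey J.edfKey_injective (J.backlog rem t) (min cap)
  rw [min_eq_right hc, sub_zero] at h
  refine le_trans (le_of_eq ?_) (h.le.trans (min_le_left _ _))
  refine Finset.sum_congr rfl fun i _ => ?_
  unfold edfStop edfStart
  congr! <;> exact J.before_iff

lemma start_le (j : Fin n) : J.start ≤ J.release j :=
  ciInf_le (Set.finite_range _).bddBelow j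

variable {J}

lemma ydsRemaining_nonneg (hJ : J.Valid) (k : ℕ) : ∀ j, 0 ≤ J.ydsRemaining k j := by
  induction k with
  | zero => exact fun j => (hJ.pos j).le
  | succ k ih =>
    intro j
    have h1 := J.edfStop_sub_le (cap := J.ydsSpeed (J.start + k)) (t := J.start + k) ih j
    have h2 : J.backlog (J.ydsRemaining k) (J.start + k) j ≤ J.ydsRemaining k j := by
      unfold backlog; split_ifs <;> simp [ih]
    simp only [ydsRemaining]
    linarith

/-- The volume of `j` that YDS processes in slot `t`. -/
noncomputable def ydsWork (J : JobSet n) (t : ℤ) (j : Fin n) : ℝ :=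
  J.edfStop (J.ydsSpeed t) (J.ydsRemaining (t - J.start).toNat) t j
    - J.edfStart (J.ydsSpeed t) (J.ydsRemaining (t - J.start).toNat) t j

lemma ydsRemaining_succ (k : ℕ) (j : Fin n) :
    J.ydsRemaining (k + 1) j = J.ydsRemaining k j - J.ydsWork (J.start + k) j := by
  simp [ydsRemaining, ydsWork]

lemma ydsWork_nonneg (hJ : J.Valid) (t : ℤ) (j : Fin n) : 0 ≤ J.ydsWork t j :=
  sub_nonneg.2 (J.edfStart_le_edfStop (ydsRemaining_nonneg hJ _) j)

lemma ydsWork_eq_zero (hJ : J.Valid) {t : ℤ} {j : Fin n} (h : t < J.release j) :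
    J.ydsWork t j = 0 := by
  refine le_antisymm ((J.edfStop_sub_le (ydsRemaining_nonneg hJ _) j).trans_eq ?_)
    (ydsWork_nonneg hJ t j)
  rw [backlog, if_neg (not_le.2 h)]

lemma ydsRemaining_eq_volume (hJ : J.Valid) {k : ℕ} {j : Fin n} (h : J.start + k ≤ J.release j) :
    J.ydsRemaining k j = J.volume j := by
  induction k with
  | zero => rfl
  | succ k ih =>
    push_cast at h
    rw [ydsRemaining_succ, ih (by omega), ydsWork_eq_zero hJ (by omega), sub_zero]

lemma sum_ydsWork {a b : ℤ} (ha : J.start ≤ a) (hab : a ≤ b) (j : Fin n) :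
    ∑ t ∈ Finset.Ico a b, J.ydsWork t j =
      J.ydsRemaining (a - J.start).toNat j - J.ydsRemaining (b - J.start).toNat j := by
  induction b, hab using Int.leInduction with
  | base => simp
  | succ b hab ih =>
    have h1 : Finset.Ico a (b + 1) = insert b (Finset.Ico a b) := by
      ext x; simp only [Finset.mem_Ico, Finset.mem_insert]; omega
    have h2 : (b + 1 - J.start).toNat = (b - J.start).toNat + 1 := by omega
    have h3 : J.start + ((b - J.start).toNat : ℤ) = b := by omega
    rw [h1, Finset.sum_insert (by simp), ih, h2, ydsRemaining_succ, h3]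
    ring

/-- Busy period argument: `t₀` is the start or the last time at which the queue of jobs up to `j`
was emptied. From then on every slot spends its whole capacity on this queue, and only jobs released
since `t₀` are in it. In the induction `t₀` is reset to `t + 1` when the backlog fits into slot `t`,
and is kept otherwise. -/
lemma queue_bound (hJ : J.Valid) (hs : ∀ t, 0 ≤ J.ydsSpeed t) (j : Fin n) (k : ℕ) :
    ∃ t₀ ≤ J.start + k,
      ∑ i ∈ J.upTo j with J.release i < J.start + k, J.ydsRemaining k i ≤
        ∑ i ∈ J.upTo j with t₀ ≤ J.release i ∧ J.release i < J.start + k, J.volume i -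
          ∑ t ∈ Finset.Ico t₀ (J.start + k), J.ydsSpeed t := by
  induction k with
  | zero =>
    refine ⟨J.start, by simp, ?_⟩
    have h1 : ∀ i, ¬ J.release i < J.start := fun i => not_lt.2 (J.start_le i)
    simp [h1]
  | succ k ih =>
    obtain ⟨t₀, ht₀, hle⟩ := ih
    set t := J.start + (k : ℤ) with ht
    have ht' : J.start + ((k + 1 : ℕ) : ℤ) = t + 1 := by rw [ht]; push_cast; ring
    rw [ht']
    have hlt : ∀ i, J.release i < t + 1 ↔ J.release i ≤ t := fun i => Int.lt_add_one_iff
    have hb : ∑ i ∈ J.upTo j with J.release i < t + 1, J.ydsRemaining k i =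
        ∑ i ∈ J.upTo j, J.backlog (J.ydsRemaining k) t i := by
      rw [Finset.sum_filter]
      exact Finset.sum_congr rfl fun i _ => by simp only [backlog, hlt]
    have hw : ∑ i ∈ J.upTo j with J.release i < t + 1, J.ydsWork t i =
        min (J.ydsSpeed t) (∑ i ∈ J.upTo j, J.backlog (J.ydsRemaining k) t i) := by
      rw [← J.sum_upTo_processed (hs t), Finset.sum_filter]
      refine Finset.sum_congr rfl fun i _ => ?_
      have h2 : (t - J.start).toNat = k := by omega
      split_ifs with h
      · rw [ydsWork, h2]
      · have := ydsWork_eq_zero hJ (j := i) (t := t) (by omega)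
        rw [ydsWork, h2] at this
        exact this.symm
    have hnext : ∑ i ∈ J.upTo j with J.release i < t + 1, J.ydsRemaining (k + 1) i =
        (∑ i ∈ J.upTo j, J.backlog (J.ydsRemaining k) t i) -
          min (J.ydsSpeed t) (∑ i ∈ J.upTo j, J.backlog (J.ydsRemaining k) t i) := by
      rw [← hw, ← hb, ← Finset.sum_sub_distrib]
      exact Finset.sum_congr rfl fun i _ => ydsRemaining_succ k i
    rw [hnext]
    rcases le_total (∑ i ∈ J.upTo j, J.backlog (J.ydsRemaining k) t i) (J.ydsSpeed t) with h | h
    · refine ⟨t + 1, le_rfl, ?_⟩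
      rw [min_eq_right h]
      rw [sub_self, Finset.Ico_self, Finset.sum_empty, sub_zero]
      exact Finset.sum_nonneg fun i _ => (hJ.pos i).le
    · refine ⟨t₀, by omega, ?_⟩
      rw [min_eq_left h, ← hb]
      have h1 : (J.upTo j).filter (fun i => J.release i < t + 1) =
          (J.upTo j).filter (fun i => J.release i < t) ∪
            (J.upTo j).filter (fun i => J.release i = t) := by
        ext i
        simp only [Finset.mem_filter, Finset.mem_union, hlt, le_iff_lt_or_eq]
        tauto
      have h2 : (J.upTo j).filter (fun i => t₀ ≤ J.release i ∧ J.release i < t + 1) =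
          (J.upTo j).filter (fun i => t₀ ≤ J.release i ∧ J.release i < t) ∪
            (J.upTo j).filter (fun i => J.release i = t) := by
        ext i
        simp only [Finset.mem_filter, Finset.mem_union, ← and_or_left]
        refine and_congr_right fun _ => ?_
        omega
      have h3 : ∑ i ∈ J.upTo j with J.release i = t, J.ydsRemaining k i =
          ∑ i ∈ J.upTo j with J.release i = t, J.volume i :=
        Finset.sum_congr rfl fun i hi =>
          ydsRemaining_eq_volume hJ (Finset.mem_filter.1 hi).2.ge
      have h4 : Finset.Ico t₀ (t + 1) = insert t (Finset.Ico t₀ t) := by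
        ext x; simp only [Finset.mem_Ico, Finset.mem_insert]; omega
      rw [h1, h2, h4, Finset.sum_insert (by simp), Finset.sum_union, Finset.sum_union, h3]
      · linarith
      all_goals
        rw [Finset.disjoint_left]
        intro i hi hi'
        simp only [Finset.mem_filter] at hi hi'
        omega

lemma YDSSpec.speed_nonneg {v : Fin n → ℝ} {C : Finset ℤ} (h : J.YDSSpec v C) (t : ℤ) :
    0 ≤ J.ydsSpeed t := by
  by_cases ht : t ∈ C
  · exact (h.pos t ht).le
  · exact (h.eq_zero t ht).ge

/-- Jobs up to `j` have deadlines at most that of `j`. Those released in the busy period therefore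
have their windows in $[t_0,d_j)$, and `capacity` on this interval makes the bound on the queue
nonpositive. -/
lemma YDSSpec.ydsRemaining_deadline {v : Fin n → ℝ} {C : Finset ℤ} (h : J.YDSSpec v C)
    (hJ : J.Valid) (j : Fin n) : J.ydsRemaining (J.deadline j - J.start).toNat j = 0 := by
  obtain ⟨t₀, ht₀, hle⟩ := queue_bound hJ h.speed_nonneg j (J.deadline j - J.start).toNat
  have h1 : J.start + ((J.deadline j - J.start).toNat : ℤ) = J.deadline j := by
    have := J.start_le j
    have := hJ.lt j
    omega
  rw [h1] at hle
  have h2 : ∑ i ∈ J.upTo j with t₀ ≤ J.release i ∧ J.release i < J.deadline j, J.volume i ≤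
      ∑ t ∈ Finset.Ico t₀ (J.deadline j), J.ydsSpeed t := by
    refine le_trans (Finset.sum_le_sum_of_subset_of_nonneg (fun i hi => ?_)
      fun i _ _ => (hJ.pos i).le) (h.capacity t₀ (J.deadline j))
    simp only [Finset.mem_filter, mem_upTo, edfKey, Prod.Lex.toLex_le_toLex] at hi
    simp only [Finset.mem_filter, Finset.mem_univ, true_and]
    exact ⟨hi.2.1, by omega⟩
  refine le_antisymm (le_trans ?_ (hle.trans (by linarith))) (ydsRemaining_nonneg hJ _ j)
  refine Finset.single_le_sum (f := fun i => J.ydsRemaining (J.deadline j - J.start).toNat i)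
    (fun i _ => ydsRemaining_nonneg hJ _ i) ?_
  simp [mem_upTo, hJ.lt j]

lemma YDSSpec.sum_ydsWork_eq {v : Fin n → ℝ} {C : Finset ℤ} (h : J.YDSSpec v C)
    (hJ : J.Valid) (j : Fin n) :
    ∑ t ∈ Finset.Ico (J.release j) (J.deadline j), J.ydsWork t j = J.volume j := by
  have := J.start_le j
  rw [sum_ydsWork this (hJ.lt j).le, h.ydsRemaining_deadline hJ, sub_zero]
  exact ydsRemaining_eq_volume hJ (by omega)

/-- The execution intervals `[lo, hi)` of the YDS schedule within a slot. -/
structure SlotSpec (J : JobSet n) : Prop where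
  lo_nonneg : ∀ t j, 0 ≤ J.ydsLo t j
  lo_le_hi : ∀ t j, J.ydsLo t j ≤ J.ydsHi t j
  hi_le_one : ∀ t j, J.ydsHi t j ≤ 1
  ordered : ∀ t i j, J.Before i j → J.ydsHi t i ≤ J.ydsLo t j
  sum_le_one : ∀ t, ∑ j, (J.ydsHi t j - J.ydsLo t j) ≤ 1
  complete : ∀ j, ∑ t ∈ Finset.Ico (J.release j) (J.deadline j),
    (J.ydsHi t j - J.ydsLo t j) * J.ydsSpeed t = J.volume j

lemma YDSSpec.slotSpec {v : Fin n → ℝ} {C : Finset ℤ} (h : J.YDSSpec v C) (hJ : J.Valid) :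
    J.SlotSpec where
  lo_nonneg t j :=
    div_nonneg (J.edfStart_nonneg (h.speed_nonneg t) (ydsRemaining_nonneg hJ _) j)
      (h.speed_nonneg t)
  lo_le_hi t j :=
    div_le_div_of_nonneg_right (J.edfStart_le_edfStop (ydsRemaining_nonneg hJ _) j)
      (h.speed_nonneg t)
  hi_le_one t j := div_le_one_of_le₀ (J.edfStop_le j) (h.speed_nonneg t)
  ordered t i j hij :=
    div_le_div_of_nonneg_right (J.edfStop_le_edfStart (ydsRemaining_nonneg hJ _) hij)
      (h.speed_nonneg t)
  sum_le_one t := by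
    simp only [ydsHi, ydsLo, ← sub_div, ← Finset.sum_div]
    exact div_le_one_of_le₀ (J.sum_processed_le (h.speed_nonneg t)) (h.speed_nonneg t)
  complete j := by
    rw [← h.sum_ydsWork_eq hJ j]
    refine Finset.sum_congr rfl fun t _ => ?_
    simp only [ydsHi, ydsLo, ← sub_div]
    change J.ydsWork t j / J.ydsSpeed t * J.ydsSpeed t = _
    -- At speed zero division yields the empty interval $[0,0)$; this agrees with the work, which
    -- capacity zero forces to vanish.
    by_cases h0 : J.ydsSpeed t = 0
    · rw [h0, mul_zero]
      refine le_antisymm (ydsWork_nonneg hJ t j) ?_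
      have h1 := J.edfStart_nonneg (t := t) h0.ge (ydsRemaining_nonneg hJ (t - J.start).toNat) j
      have h2 := J.edfStop_le (cap := J.ydsSpeed t)
        (rem := J.ydsRemaining (t - J.start).toNat) (t := t) j
      rw [ydsWork]
      linarith
    · exact div_mul_cancel₀ _ h0

end JobSet

open MeasureTheory

/-! ### Inequalities for finite sums -/

/-- Integration over all levels `θ` of an inequality between sums over superlevel sets. -/
lemma sum_rpow_nonneg_of_levels {ι : Type*} (T : Finset ι) {M a b : ι → ℝ} {r s : ℝ}
    (hr : -1 < r) (hs : -1 < s) (hM : ∀ t ∈ T, 0 ≤ M t)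
    (h : ∀ θ, 0 < θ → 0 ≤ ∑ t ∈ T with θ ≤ M t, (a t * θ ^ r + b t * θ ^ s)) :
    0 ≤ ∑ t ∈ T, (a t * (M t ^ (r + 1) / (r + 1)) + b t * (M t ^ (s + 1) / (s + 1))) := by
  have hint : ∀ t ∈ T, IntegrableOn (fun θ : ℝ => a t * θ ^ r + b t * θ ^ s)
      (Set.Ioc 0 (M t)) := by
    intro t ht
    have h1 := ((intervalIntegral.intervalIntegrable_rpow' (a := 0) (b := M t) hr).const_mul
      (a t)).add ((intervalIntegral.intervalIntegrable_rpow' (a := 0) (b := M t) hs).const_mul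
      (b t))
    exact (intervalIntegrable_iff_integrableOn_Ioc_of_le (hM t ht)).1 h1
  have hval : ∀ t ∈ T, ∫ θ in Set.Ioc 0 (M t), (a t * θ ^ r + b t * θ ^ s) =
      a t * (M t ^ (r + 1) / (r + 1)) + b t * (M t ^ (s + 1) / (s + 1)) := by
    intro t ht
    rw [← intervalIntegral.integral_of_le (hM t ht), intervalIntegral.integral_add
      ((intervalIntegral.intervalIntegrable_rpow' hr).const_mul _)
      ((intervalIntegral.intervalIntegrable_rpow' hs).const_mul _),
      intervalIntegral.integral_const_mul, intervalIntegral.integral_const_mul,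
      integral_rpow (Or.inl hr), integral_rpow (Or.inl hs), Real.zero_rpow (by linarith),
      Real.zero_rpow (by linarith), sub_zero, sub_zero]
  have hF : 0 ≤ ∫ θ : ℝ, ∑ t ∈ T,
      (Set.Ioc 0 (M t)).indicator (fun θ => a t * θ ^ r + b t * θ ^ s) θ := by
    refine integral_nonneg fun θ => ?_
    show 0 ≤ ∑ t ∈ T, (Set.Ioc 0 (M t)).indicator (fun θ => a t * θ ^ r + b t * θ ^ s) θ
    by_cases hθ : 0 < θ
    · refine (h θ hθ).trans_eq ?_
      rw [Finset.sum_filter]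
      exact Finset.sum_congr rfl fun t _ => by simp [Set.indicator, hθ]
    · exact (Finset.sum_eq_zero fun t _ => by simp [Set.indicator, hθ]).ge
  rw [integral_finsetSum _ fun t ht =>
    (integrable_indicator_iff measurableSet_Ioc).2 (hint t ht)] at hF
  refine hF.trans_eq (Finset.sum_congr rfl fun t ht => ?_)
  rw [integral_indicator measurableSet_Ioc, hval t ht]

/-- Layer-cake formula on the disjoint union of the index sets, with coefficient $C$ on `A`, $-1$ on
`B` and weight $\theta^{\alpha-1}$. -/
lemma sum_rpow_le_of_card_levels {ι κ : Type*} (A : Finset ι) (B : Finset κ) {f : ι → ℝ}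
    {g : κ → ℝ} {C α : ℝ} (hα : 0 < α) (hf : ∀ t ∈ A, 0 ≤ f t) (hg : ∀ t ∈ B, 0 ≤ g t)
    (h : ∀ θ, 0 < θ → ((B.filter fun t => θ ≤ g t).card : ℝ) ≤
      C * ((A.filter fun t => θ ≤ f t).card : ℝ)) :
    ∑ t ∈ B, g t ^ α ≤ C * ∑ t ∈ A, f t ^ α := by
  have key := sum_rpow_nonneg_of_levels (A.disjSum B) (M := Sum.elim f g)
    (a := Sum.elim (fun _ => C) (fun _ => -1)) (b := fun _ => 0) (r := α - 1) (s := 0)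
    (by linarith) (by norm_num) (by
      rintro (t | t) ht
      · exact hf t (by simpa using ht)
      · exact hg t (by simpa using ht)) (by
      intro θ hθ
      rw [Finset.sum_filter, Finset.sum_disjSum]
      simp only [Sum.elim_inl, Sum.elim_inr, ← Finset.sum_filter, Finset.sum_const,
        nsmul_eq_mul, zero_mul, add_zero]
      have h1 := mul_le_mul_of_nonneg_right (h θ hθ) (Real.rpow_nonneg hθ.le (α - 1))
      linarith)
  rw [Finset.sum_disjSum] at key
  simp only [Sum.elim_inl, Sum.elim_inr, zero_mul, add_zero, sub_add_cancel,
    ← Finset.mul_sum, ← Finset.sum_div] at key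
  have h2 : 0 ≤ (C * ∑ t ∈ A, f t ^ α - ∑ t ∈ B, g t ^ α) / α := by
    rw [sub_div]; linarith [mul_div_assoc C (∑ t ∈ A, f t ^ α) α]
  rw [le_div_iff₀ hα, zero_mul] at h2
  linarith

/-- Absorption after Hölder: raise to the power $\alpha$, use $\alpha/p=\alpha-1$, and cancel
$E^{\alpha-1}$. -/
lemma le_of_le_rpow_mul_rpow {E a K α p : ℝ} (hpq : α.HolderConjugate p) (hE : 0 ≤ E)
    (ha : 0 ≤ a) (hK : 0 ≤ K) (h : E ≤ a ^ (1 / α) * (K * E) ^ (1 / p)) :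
    E ≤ a * K ^ (α - 1) := by
  rcases hE.eq_or_lt with rfl | hE
  · positivity
  have hα := hpq.pos
  have h1 : E ^ α ≤ (a ^ (1 / α) * (K * E) ^ (1 / p)) ^ α := Real.rpow_le_rpow hE.le h hα.le
  have h2 : 1 / p * α = α - 1 := by
    have h3 := hpq.inv_add_inv_eq_one
    have h4 := hα.ne'
    have : 1 / p = 1 - α⁻¹ := by rw [one_div]; linarith
    rw [this]; field_simp
  rw [Real.mul_rpow (by positivity) (by positivity), ← Real.rpow_mul ha,
    ← Real.rpow_mul (by positivity), one_div_mul_cancel hα.ne', Real.rpow_one, h2,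
    Real.mul_rpow hK hE.le, Real.rpow_sub_one hE.ne'] at h1
  have h5 : 0 < E ^ α := Real.rpow_pos_of_pos hE α
  have h6 : E ^ α * E ≤ E ^ α * (a * K ^ (α - 1)) := by
    have := mul_le_mul_of_nonneg_right h1 hE.le
    rw [← mul_assoc, mul_div_assoc', div_mul_cancel₀ _ hE.ne'] at this
    linarith
  exact le_of_mul_le_mul_left h6 h5

/-- The sharp maximal inequality follows from the inequality on superlevel sets. -/
lemma sum_rpow_le_of_levels {ι : Type*} (T : Finset ι) {M g : ι → ℝ} {p q : ℝ}
    (hpq : p.HolderConjugate q) (hM : ∀ t ∈ T, 0 ≤ M t) (hg : ∀ t ∈ T, 0 ≤ g t)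
    (h : ∀ θ, 0 < θ → 0 ≤ ∑ t ∈ T with θ ≤ M t, (g t - θ)) :
    ∑ t ∈ T, M t ^ p ≤ q ^ p * ∑ t ∈ T, g t ^ p := by
  have hp := hpq.lt
  have hp0 := hpq.pos
  -- Integrating the level inequality against $\theta^{p-2}$ yields $\frac1p\sum
  -- M^p\le\frac1{p-1}\sum g M^{p-1}$, that is $\sum M^p\le q\sum gM^{p-1}$. Hölder and absorption
  -- then give the constant $q^p$.
  have key := sum_rpow_nonneg_of_levels T (M := M) (a := g) (b := fun _ => -1) (r := p - 2)
    (s := p - 1) (by linarith) (by linarith) hM (by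
      intro θ hθ
      have : ∀ t, g t * θ ^ (p - 2) + -1 * θ ^ (p - 1) = (g t - θ) * θ ^ (p - 2) := by
        intro t
        have : θ ^ (p - 1) = θ ^ (p - 2) * θ := by
          rw [← Real.rpow_add_one hθ.ne']; congr 1; ring
        rw [this]; ring
      simp only [this, ← Finset.sum_mul]
      exact mul_nonneg (h θ hθ) (Real.rpow_nonneg hθ.le _))
  have e1 : p - 2 + 1 = p - 1 := by ring
  have e2 : p - 1 + 1 = p := by ring
  rw [e1, e2] at key
  have hX : 0 ≤ ∑ t ∈ T, M t ^ p := Finset.sum_nonneg fun t ht => Real.rpow_nonneg (hM t ht) _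
  have hG : 0 ≤ ∑ t ∈ T, g t ^ p := Finset.sum_nonneg fun t ht => Real.rpow_nonneg (hg t ht) _
  have hq : q = p / (p - 1) := hpq.conjugate_eq
  have h1 : ∑ t ∈ T, M t ^ p ≤ q * ∑ t ∈ T, g t * M t ^ (p - 1) := by
    have h2 : ∑ t ∈ T, (g t * (M t ^ (p - 1) / (p - 1)) + -1 * (M t ^ p / p)) =
        (∑ t ∈ T, g t * M t ^ (p - 1)) / (p - 1) - (∑ t ∈ T, M t ^ p) / p := by
      rw [Finset.sum_div, Finset.sum_div, ← Finset.sum_sub_distrib]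
      exact Finset.sum_congr rfl fun t _ => by ring
    rw [h2, sub_nonneg, div_le_iff₀ hp0] at key
    rw [hq]
    refine key.trans_eq ?_
    ring
  have h3 : ∑ t ∈ T, g t * M t ^ (p - 1) ≤
      (∑ t ∈ T, g t ^ p) ^ (1 / p) * (∑ t ∈ T, M t ^ p) ^ (1 / q) := by
    refine (Real.inner_le_Lp_mul_Lq_of_nonneg T hpq hg
      fun t ht => Real.rpow_nonneg (hM t ht) _).trans_eq ?_
    congr 2
    refine Finset.sum_congr rfl fun t ht => ?_
    rw [← Real.rpow_mul (hM t ht), hpq.sub_one_mul_conj]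
  have hq0 : 0 ≤ q := hpq.symm.pos.le
  have h4 : ∑ t ∈ T, M t ^ p ≤
      (q ^ p * ∑ t ∈ T, g t ^ p) ^ (1 / p) * (1 * ∑ t ∈ T, M t ^ p) ^ (1 / q) := by
    rw [Real.mul_rpow (by positivity) hG, ← Real.rpow_mul hq0, mul_one_div_cancel hp0.ne',
      Real.rpow_one, one_mul, mul_assoc]
    exact h1.trans (mul_le_mul_of_nonneg_left h3 hq0)
  have := le_of_le_rpow_mul_rpow hpq hX (by positivity) zero_le_one h4
  rwa [Real.one_rpow, mul_one] at this

/-! ### Sharp maximal inequalities on the integers. -/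

/-- Rising sun lemma for a sequence. -/
lemma sum_Ico_le_sum_filter (h : ℤ → ℝ) {N L : ℤ} (hLN : L ≤ N) (E : ℤ → Prop)
    [DecidablePred E] (hE : ∀ t < N, E t ↔ ∃ b, t < b ∧ b ≤ N ∧ 0 ≤ ∑ u ∈ Finset.Ico t b, h u) :
    ∀ b, L ≤ b → b ≤ N → ∑ u ∈ Finset.Ico L b, h u ≤ ∑ t ∈ Finset.Ico L N with E t, h t := by
  -- Only `b = L` is needed later, but the induction needs every `b`. If `L - 1` satisfies `E`, its
  -- term is added on both sides, and the empty sum is handled by the witness of `E`. If it does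
  -- not, every nonempty sum from `L - 1` is negative, whereas the right side is nonnegative by
  -- induction.
  induction L, hLN using Int.leInductionDown with
  | base =>
    intro b h1 h2
    simp [le_antisymm h2 h1]
  | pred L hLN ih =>
    have hins : ∀ b, L ≤ b → Finset.Ico (L - 1) b = insert (L - 1) (Finset.Ico L b) := by
      intro b hb
      ext x; simp only [Finset.mem_Ico, Finset.mem_insert]; omega
    have hsum : ∀ b, L ≤ b → ∑ u ∈ Finset.Ico (L - 1) b, h u =
        h (L - 1) + ∑ u ∈ Finset.Ico L b, h u := by
      intro b hb
      rw [hins b hb, Finset.sum_insert (by simp)]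
    by_cases hL : E (L - 1)
    · have hF : ∑ t ∈ Finset.Ico (L - 1) N with E t, h t =
          h (L - 1) + ∑ t ∈ Finset.Ico L N with E t, h t := by
        rw [hins N hLN, Finset.filter_insert, if_pos hL, Finset.sum_insert (by simp)]
      have hge : ∀ b, L ≤ b → b ≤ N →
          ∑ u ∈ Finset.Ico (L - 1) b, h u ≤ ∑ t ∈ Finset.Ico (L - 1) N with E t, h t := by
        intro b h1 h2
        rw [hF, hsum b h1]
        linarith [ih b h1 h2]
      intro b h1 h2
      rcases h1.eq_or_lt with rfl | h1
      · obtain ⟨b', hb1, hb2, hb3⟩ := (hE (L - 1) (by omega)).1 hL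
        rw [Finset.Ico_self, Finset.sum_empty]
        exact hb3.trans (hge b' (by omega) hb2)
      · exact hge b (by omega) h2
    · have hF : ∑ t ∈ Finset.Ico (L - 1) N with E t, h t =
          ∑ t ∈ Finset.Ico L N with E t, h t := by
        rw [hins N hLN, Finset.filter_insert, if_neg hL]
      have h0 : 0 ≤ ∑ t ∈ Finset.Ico L N with E t, h t := by
        have := ih L le_rfl hLN
        rwa [Finset.Ico_self, Finset.sum_empty] at this
      intro b h1 h2
      rw [hF]
      rcases h1.eq_or_lt with rfl | h1
      · rwa [Finset.Ico_self, Finset.sum_empty]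
      · by_contra! hc
        exact hL ((hE (L - 1) (by omega)).2 ⟨b, h1, h2, h0.trans hc.le⟩)

/-- The sharp one-sided Hardy–Littlewood maximal inequality for sequences. -/
lemma exists_right_maximal {g : ℤ → ℝ} (hg : ∀ t, 0 ≤ g t) {p q : ℝ}
    (hpq : p.HolderConjugate q) (L N : ℤ) :
    ∃ M : ℤ → ℝ, (∀ t, 0 ≤ M t) ∧
      (∀ t b, t < b → b ≤ N → ∑ u ∈ Finset.Ico t b, g u ≤ M t * ((b : ℝ) - t)) ∧
      ∑ t ∈ Finset.Ico L N, M t ^ p ≤ q ^ p * ∑ t ∈ Finset.Ico L N, g t ^ p := by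
  -- For `t < N` the range is $(t,N]$; the maximum with `t + 1` only keeps it nonempty for the other
  -- `t`.
  have hne : ∀ t : ℤ, (Finset.Ioc t (max N (t + 1))).Nonempty := fun t =>
    ⟨t + 1, by simp⟩
  set avg : ℤ → ℤ → ℝ := fun t b => (∑ u ∈ Finset.Ico t b, g u) / ((b : ℝ) - t) with havg
  set M : ℤ → ℝ := fun t => (Finset.Ioc t (max N (t + 1))).sup' (hne t) (avg t) with hM
  have hpos : ∀ {t b : ℤ}, t < b → 0 < (b : ℝ) - t := fun h => by
    rw [sub_pos]; exact_mod_cast h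
  have hM0 : ∀ t, 0 ≤ M t := by
    intro t
    refine (Finset.le_sup'_iff (hne t)).2 ⟨t + 1, by simp, ?_⟩
    exact div_nonneg (Finset.sum_nonneg fun u _ => hg u) (hpos (by omega)).le
  refine ⟨M, hM0, ?_, ?_⟩
  · intro t b h1 h2
    rw [← div_le_iff₀ (hpos h1)]
    exact Finset.le_sup' (avg t) (Finset.mem_Ioc.2 ⟨h1, h2.trans (le_max_left _ _)⟩)
  · rcases le_or_gt L N with hLN | hLN
    swap
    · simp [Finset.Ico_eq_empty (not_lt.2 hLN.le)]
    refine sum_rpow_le_of_levels _ hpq (fun t _ => hM0 t) (fun t _ => hg t) fun θ hθ => ?_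
    -- Some average of $g$ from $t$ reaches $\theta$ exactly when some sum of $g-\theta$ from $t$ is
    -- nonnegative, so the superlevel set of `M` is the rising sun set of $g-\theta$.
    have := sum_Ico_le_sum_filter (fun u => g u - θ) hLN (fun t => θ ≤ M t) (by
      intro t ht
      rw [Finset.le_sup'_iff, max_eq_left (by omega)]
      refine exists_congr fun b => ?_
      rw [Finset.mem_Ioc, and_assoc]
      refine and_congr_right fun h1 => and_congr_right fun h2 => ?_
      rw [havg, le_div_iff₀ (hpos h1), Finset.sum_sub_distrib, Finset.sum_const, Int.card_Ico,
        sub_nonneg, nsmul_eq_mul, mul_comm]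
      have : (((b - t).toNat : ℕ) : ℝ) = (b : ℝ) - t := by
        have h3 : (((b - t).toNat : ℕ) : ℤ) = b - t := Int.toNat_of_nonneg (by omega)
        exact_mod_cast congrArg (fun z : ℤ => (z : ℝ)) h3
      rw [this]) L le_rfl hLN
    rwa [Finset.Ico_self, Finset.sum_empty] at this

/-- Reflection $u\mapsto -1-u$ of slots, hence $t\mapsto -t$ of endpoints. The averages end before
slot $t$, so the left side runs over $(L,N]$ rather than $[L,N)$. -/
lemma exists_left_maximal {g : ℤ → ℝ} (hg : ∀ t, 0 ≤ g t) {p q : ℝ}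
    (hpq : p.HolderConjugate q) (L N : ℤ) :
    ∃ M : ℤ → ℝ, (∀ t, 0 ≤ M t) ∧
      (∀ a t, L ≤ a → a < t → ∑ u ∈ Finset.Ico a t, g u ≤ M t * ((t : ℝ) - a)) ∧
      ∑ t ∈ Finset.Ioc L N, M t ^ p ≤ q ^ p * ∑ t ∈ Finset.Ico L N, g t ^ p := by
  have hrefl : ∀ (f : ℤ → ℝ) (a b : ℤ), ∑ u ∈ Finset.Ico (-b) (-a), f (-1 - u) =
      ∑ u ∈ Finset.Ico a b, f u := by
    intro f a b
    refine Finset.sum_nbij' (fun u => -1 - u) (fun u => -1 - u) ?_ ?_ ?_ ?_ ?_ <;>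
      intro u <;> simp only [Finset.mem_Ico] <;> intros <;> first | omega | trivial
  obtain ⟨M, hM0, hM1, hM2⟩ := exists_right_maximal (g := fun u => g (-1 - u))
    (fun t => hg _) hpq (-N) (-L)
  refine ⟨fun t => M (-t), fun t => hM0 _, ?_, ?_⟩
  · intro a t h1 h2
    have := hM1 (-t) (-a) (by omega) (by omega)
    rw [hrefl g] at this
    refine this.trans_eq ?_
    push_cast
    ring
  · rw [hrefl (fun u => g u ^ p)] at hM2
    refine le_of_eq_of_le ?_ hM2
    refine Finset.sum_nbij' (fun u => -u) (fun u => -u) ?_ ?_ ?_ ?_ ?_ <;>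
      intro u <;> simp only [Finset.mem_Ico, Finset.mem_Ioc] <;> intros <;> first | omega | simp

/-- An interval containing slot $t$ is cut at $t$ and each half is bounded by its one-sided maximal
function. The factor 2 comes from $\max(x,y)^p\le x^p+y^p$. -/
lemma exists_maximal {g : ℤ → ℝ} (hg : ∀ t, 0 ≤ g t) {p q : ℝ} (hpq : p.HolderConjugate q)
    (L N : ℤ) :
    ∃ m : ℤ → ℝ, (∀ t, 0 ≤ m t) ∧
      (∀ a b t, L ≤ a → a ≤ t → t < b → b ≤ N →
        ∑ u ∈ Finset.Ico a b, g u ≤ m t * ((b : ℝ) - a)) ∧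
      ∑ t ∈ Finset.Ico L N, m t ^ p ≤ 2 * q ^ p * ∑ t ∈ Finset.Ico L N, g t ^ p := by
  obtain ⟨M, hM0, hM1, hM2⟩ := exists_right_maximal hg hpq L N
  obtain ⟨M', hM0', hM1', hM2'⟩ := exists_left_maximal hg hpq L N
  -- The left maximal function is not controlled at $t=L$, but there the left half of an admissible
  -- interval is empty.
  refine ⟨fun t => if L < t then max (M t) (M' t) else M t, ?_, ?_, ?_⟩
  · intro t
    dsimp only
    split_ifs
    · exact (hM0 t).trans (le_max_left _ _)
    · exact hM0 t
  · intro a b t h1 h2 h3 h4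
    dsimp only
    have hr := hM1 t b h3 h4
    have e1 : (0 : ℝ) ≤ (b : ℝ) - t := by rw [sub_nonneg]; exact_mod_cast h3.le
    have e2 : (0 : ℝ) ≤ (t : ℝ) - a := by rw [sub_nonneg]; exact_mod_cast h2
    rcases h2.eq_or_lt with rfl | h2
    · refine hr.trans (mul_le_mul_of_nonneg_right ?_ e1)
      split_ifs
      · exact le_max_left _ _
      · exact le_rfl
    · rw [if_pos (by omega), ← Finset.Ico_union_Ico_eq_Ico h2.le h3.le,
        Finset.sum_union (Finset.Ico_disjoint_Ico_consecutive a t b)]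
      have hl := hM1' a t h1 h2
      have h5 := mul_le_mul_of_nonneg_right (le_max_left (M t) (M' t)) e1
      have h6 := mul_le_mul_of_nonneg_right (le_max_right (M t) (M' t)) e2
      linarith
  · have h1 : ∀ t ∈ Finset.Ico L N, (if L < t then max (M t) (M' t) else M t) ^ p ≤
        M t ^ p + if L < t then M' t ^ p else 0 := by
      intro t _
      have := Real.rpow_nonneg (hM0 t) p
      have := Real.rpow_nonneg (hM0' t) p
      split_ifs
      · rcases max_choice (M t) (M' t) with h | h <;> rw [h] <;> linarith
      · linarith
    refine (Finset.sum_le_sum h1).trans ?_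
    rw [Finset.sum_add_distrib, ← Finset.sum_filter]
    have h2 : ∑ t ∈ Finset.Ico L N with L < t, M' t ^ p ≤ ∑ t ∈ Finset.Ioc L N, M' t ^ p := by
      refine Finset.sum_le_sum_of_subset_of_nonneg (fun t ht => ?_)
        fun t _ _ => Real.rpow_nonneg (hM0' t) p
      simp only [Finset.mem_filter, Finset.mem_Ico, Finset.mem_Ioc] at ht ⊢
      omega
    linarith

/-! ### Lower bounds on the energy of a feasible schedule -/

lemma lintegral_comp_floor (F : ℤ → ℝ≥0∞) : ∫⁻ τ : ℝ, F ⌊τ⌋ = ∑' t, F t := by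
  have h1 : ∫⁻ τ : ℝ, F ⌊τ⌋ = ∫⁻ τ in ⋃ t : ℤ, Set.Ico (t : ℝ) (t + 1), F ⌊τ⌋ := by
    rw [iUnion_Ico_intCast, Measure.restrict_univ]
  rw [h1, lintegral_iUnion (fun _ => measurableSet_Ico) (Set.pairwise_disjoint_Ico_intCast ℝ)]
  refine tsum_congr fun t => ?_
  rw [setLIntegral_congr_fun (g := fun _ => F t) measurableSet_Ico
    (fun τ hτ => by simp only [Int.floor_eq_iff.2 hτ]), setLIntegral_const, Real.volume_Ico]
  simp

lemma Schedule.IsFeasible.disjoint_running {n : ℕ} (S : Schedule n) :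
    Pairwise (Function.onFun Disjoint fun j => {τ | S.job τ = some j}) := by
  intro i j hij
  refine Set.disjoint_left.2 fun τ h1 h2 => hij ?_
  simpa using h1.symm.trans h2

/-- Hölder's inequality for a feasible schedule: a lower bound on its energy from weights `c` of
the jobs and weights `m` of the slots with `c j ≤ m t` on the window of `j`. -/
lemma Schedule.IsFeasible.le_energy {n : ℕ} {S : Schedule n} {J : JobSet n}
    (hS : S.IsFeasible J) {α p : ℝ} (hpq : α.HolderConjugate p) {c : Fin n → ℝ} {m : ℤ → ℝ}
    {T : Finset ℤ} (hw : ∀ j, 0 ≤ J.volume j) (hc : ∀ j, 0 ≤ c j) (hm : ∀ t, 0 ≤ m t)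
    (hT : ∀ j, Finset.Ico (J.release j) (J.deadline j) ⊆ T)
    (hcm : ∀ j, ∀ t ∈ Finset.Ico (J.release j) (J.deadline j), c j ≤ m t) {K : ℝ} (hK : 0 < K)
    (hle : ∑ t ∈ T, m t ^ p ≤ K * ∑ j, J.volume j * c j) :
    ENNReal.ofReal (∑ j, J.volume j * c j) ≤ ENNReal.ofReal (K ^ (α - 1)) * S.energy α := by
  classical
  set E := ∑ j, J.volume j * c j with hE
  have hE0 : 0 ≤ E := Finset.sum_nonneg fun j _ => mul_nonneg (hw j) (hc j)
  have hKp : 0 < K ^ (α - 1) := Real.rpow_pos_of_pos hK _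
  have hα := hpq.pos
  have hp := hpq.symm.pos
  -- Infinite energy is split off so that Hölder's bound can be read as one between real numbers and
  -- $E$ absorbed.
  by_cases htop : S.energy α = ⊤
  · rw [htop, ENNReal.mul_top (by simpa using hKp)]; exact le_top
  set F : ℤ → ℝ≥0∞ := fun t => if t ∈ T then ENNReal.ofReal (m t) else 0 with hF
  have hmeasF : Measurable fun τ : ℝ => F ⌊τ⌋ :=
    (measurable_of_countable F).comp Int.measurable_floor
  have hspeed : Measurable fun τ => ENNReal.ofReal (S.speed τ) :=
    hS.measurable_speed.ennreal_ofReal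
  have h1 : ENNReal.ofReal E ≤ ∫⁻ τ, ENNReal.ofReal (S.speed τ) * F ⌊τ⌋ := by
    calc ENNReal.ofReal E
        = ∑ j, ENNReal.ofReal (J.volume j) * ENNReal.ofReal (c j) := by
          rw [hE, ENNReal.ofReal_sum_of_nonneg fun j _ => mul_nonneg (hw j) (hc j)]
          exact Finset.sum_congr rfl fun j _ => ENNReal.ofReal_mul (hw j)
      _ ≤ ∑ j, ∫⁻ τ in {τ | S.job τ = some j}, ENNReal.ofReal (S.speed τ) * F ⌊τ⌋ := by
          refine Finset.sum_le_sum fun j _ => ?_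
          calc _ ≤ (∫⁻ τ in {τ | S.job τ = some j}, ENNReal.ofReal (S.speed τ)) *
                ENNReal.ofReal (c j) := by gcongr; exact hS.completed j
            _ = ∫⁻ τ in {τ | S.job τ = some j}, ENNReal.ofReal (S.speed τ) *
                ENNReal.ofReal (c j) := (lintegral_mul_const _ hspeed).symm
            _ ≤ _ := by
              refine setLIntegral_mono (hspeed.mul hmeasF) fun τ hτ => ?_
              gcongr
              obtain ⟨h2, h3⟩ := hS.in_window τ j hτ
              have h4 : ⌊τ⌋ ∈ Finset.Ico (J.release j) (J.deadline j) :=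
                Finset.mem_Ico.2 ⟨Int.le_floor.2 h2, Int.floor_lt.2 h3⟩
              rw [hF]
              simp only [if_pos (hT j h4)]
              exact ENNReal.ofReal_le_ofReal (hcm j _ h4)
      _ = ∫⁻ τ in ⋃ j, {τ | S.job τ = some j}, ENNReal.ofReal (S.speed τ) * F ⌊τ⌋ := by
          rw [lintegral_iUnion hS.measurable_job (disjoint_running S), tsum_fintype]
      _ ≤ _ := setLIntegral_le_lintegral _ _
  have h2 : ∫⁻ τ, ENNReal.ofReal (S.speed τ) * F ⌊τ⌋ ≤
      (S.energy α) ^ (1 / α) * (∑ t ∈ T, ENNReal.ofReal (m t ^ p)) ^ (1 / p) := by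
    refine (ENNReal.lintegral_mul_le_Lp_mul_Lq volume hpq hspeed.aemeasurable
      hmeasF.aemeasurable).trans_eq ?_
    congr 2
    · exact lintegral_congr fun τ => ENNReal.ofReal_rpow_of_nonneg (hS.speed_nonneg τ) hα.le
    · rw [lintegral_comp_floor fun t => F t ^ p, tsum_eq_sum (s := T)]
      · refine Finset.sum_congr rfl fun t ht => ?_
        rw [hF]
        simp only [if_pos ht]
        exact ENNReal.ofReal_rpow_of_nonneg (hm t) hp.le
      · intro t ht
        rw [hF]
        simp only [if_neg ht]
        exact ENNReal.zero_rpow_of_pos hp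
  have h3 : ENNReal.ofReal E ≤
      ENNReal.ofReal ((S.energy α).toReal ^ (1 / α) * (K * E) ^ (1 / p)) := by
    refine (h1.trans h2).trans ?_
    rw [ENNReal.ofReal_mul (by positivity),
      ← ENNReal.ofReal_rpow_of_nonneg ENNReal.toReal_nonneg (by positivity),
      ENNReal.ofReal_toReal htop,
      ← ENNReal.ofReal_rpow_of_nonneg (mul_nonneg hK.le hE0) (by positivity),
      ← ENNReal.ofReal_sum_of_nonneg fun t _ => Real.rpow_nonneg (hm t) p]
    gcongr
  rw [ENNReal.ofReal_le_ofReal_iff (by positivity)] at h3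
  have h4 := le_of_le_rpow_mul_rpow hpq hE0 ENNReal.toReal_nonneg hK.le h3
  calc ENNReal.ofReal E ≤ ENNReal.ofReal ((S.energy α).toReal * K ^ (α - 1)) :=
        ENNReal.ofReal_le_ofReal h4
    _ = _ := by
      rw [ENNReal.ofReal_mul ENNReal.toReal_nonneg, ENNReal.ofReal_toReal htop, mul_comm]

lemma exists_cover {n : ℕ} (J : JobSet n) :
    ∃ L N : ℤ, ∀ j, L ≤ J.release j ∧ J.deadline j ≤ N := by
  obtain ⟨L, hL⟩ := (Set.finite_range J.release).bddBelow
  obtain ⟨N, hN⟩ := (Set.finite_range J.deadline).bddAbove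
  exact ⟨L, N, fun j => ⟨hL ⟨j, rfl⟩, hN ⟨j, rfl⟩⟩⟩

/-- The speed of the average rate heuristic in slot `t`. -/
noncomputable def JobSet.avrSpeed {n : ℕ} (J : JobSet n) (t : ℤ) : ℝ :=
  ∑ j with J.release j ≤ t ∧ t < J.deadline j,
    J.volume j / ((J.deadline j : ℝ) - (J.release j : ℝ))

lemma JobSet.avrSpeed_nonneg {n : ℕ} {J : JobSet n} (hJ : J.Valid) (t : ℤ) :
    0 ≤ J.avrSpeed t := by
  refine Finset.sum_nonneg fun j _ => div_nonneg (hJ.pos j).le ?_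
  rw [sub_nonneg]; exact_mod_cast (hJ.lt j).le

/-- The average rate heuristic uses at most `2 ^ (α - 1) * α ^ α` times the optimal energy. -/
lemma JobSet.avr_le_energy {n : ℕ} {J : JobSet n} (hJ : J.Valid) {α : ℝ} (hα : 1 < α)
    {S : Schedule n} (hS : S.IsFeasible J) {L N : ℤ}
    (hLN : ∀ j, L ≤ J.release j ∧ J.deadline j ≤ N) :
    ENNReal.ofReal (∑ t ∈ Finset.Ico L N, J.avrSpeed t ^ α) ≤
      ENNReal.ofReal (2 ^ (α - 1) * α ^ α) * S.energy α := by
  have hpq : α.HolderConjugate (α.conjExponent) := Real.HolderConjugate.conjExponent hα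
  set p := α.conjExponent
  have hA0 : ∀ t, 0 ≤ J.avrSpeed t := J.avrSpeed_nonneg hJ
  have hlen : ∀ j, 0 < (J.deadline j : ℝ) - (J.release j : ℝ) := fun j => by
    rw [sub_pos]; exact_mod_cast hJ.lt j
  -- With window averages of `g` as job weights, $w_jc_j$ is the density of $j$ times the sum of `g`
  -- over its window. Summed over $j$ this is $\sum_t A_t\cdot A_t^{\alpha-1}$.
  set g : ℤ → ℝ := fun t => J.avrSpeed t ^ (α - 1) with hg
  have hg0 : ∀ t, 0 ≤ g t := fun t => Real.rpow_nonneg (hA0 t) _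
  obtain ⟨m, hm0, hm1, hm2⟩ := exists_maximal hg0 hpq.symm L N
  set c : Fin n → ℝ := fun j => (∑ t ∈ Finset.Ico (J.release j) (J.deadline j), g t) /
    ((J.deadline j : ℝ) - (J.release j : ℝ)) with hc
  have hgp : ∀ t, g t ^ p = J.avrSpeed t ^ α := fun t => by
    rw [hg, ← Real.rpow_mul (hA0 t), hpq.sub_one_mul_conj]
  have hsum : ∑ j, J.volume j * c j = ∑ t ∈ Finset.Ico L N, J.avrSpeed t ^ α := by
    have h1 : ∀ t, J.avrSpeed t ^ α = ∑ j, if J.release j ≤ t ∧ t < J.deadline j then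
        J.volume j / ((J.deadline j : ℝ) - (J.release j : ℝ)) * g t else 0 := by
      intro t
      rw [← Finset.sum_filter, ← Finset.sum_mul]
      change _ = J.avrSpeed t * J.avrSpeed t ^ (α - 1)
      rcases (hA0 t).eq_or_lt with h | h
      · rw [← h, zero_mul, Real.zero_rpow (by linarith)]
      · rw [mul_comm, ← Real.rpow_add_one h.ne', sub_add_cancel]
    simp only [h1]
    rw [Finset.sum_comm]
    refine Finset.sum_congr rfl fun j _ => ?_
    have h2 : (Finset.Ico L N).filter (fun t => J.release j ≤ t ∧ t < J.deadline j) =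
        Finset.Ico (J.release j) (J.deadline j) := by
      ext t
      have := hLN j
      simp only [Finset.mem_filter, Finset.mem_Ico]
      omega
    rw [← Finset.sum_filter, h2, ← Finset.mul_sum, hc]
    ring
  have hK : (2 : ℝ) ^ (α - 1) * α ^ α = (2 * α ^ p) ^ (α - 1) := by
    rw [Real.mul_rpow (by norm_num) (by positivity), ← Real.rpow_mul (by positivity), mul_comm p,
      hpq.sub_one_mul_conj]
  rw [← hsum, hK]
  refine hS.le_energy hpq (T := Finset.Ico L N) (m := m) (fun j => (hJ.pos j).le)
    (fun j => div_nonneg (Finset.sum_nonneg fun t _ => hg0 t) (hlen j).le) hm0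
    (fun j => Finset.Ico_subset_Ico (hLN j).1 (hLN j).2) (fun j t ht => ?_) (by positivity) ?_
  · rw [div_le_iff₀ (hlen j)]
    rw [Finset.mem_Ico] at ht
    exact hm1 _ _ t (hLN j).1 ht.1 ht.2 (hLN j).2
  · rw [hsum]
    simpa only [hgp] using hm2

/-! ### YDS compared with schedules for dilated windows. -/

/-- Dilating intervals multiplies the measure of their union at most by the dilation factor. -/
lemma volume_biUnion_dilation_le (k : ℝ) (hk : 0 ≤ k) (N : ℕ) : ∀ F : Finset (ℝ × ℝ),
    F.card ≤ N → (∀ x ∈ F, x.1 < x.2) →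
    volume (⋃ x ∈ F, Set.Ico (x.1 - k * (x.2 - x.1)) (x.2 + k * (x.2 - x.1))) ≤
      ENNReal.ofReal (1 + 2 * k) * volume (⋃ x ∈ F, Set.Ico x.1 x.2) := by
  classical
  induction N with
  | zero =>
    intro F hF _
    simp [Finset.card_eq_zero.1 (Nat.le_zero.1 hF)]
  | succ N ih =>
    intro F hF hlt
    by_cases hd : (F : Set (ℝ × ℝ)).PairwiseDisjoint fun x => Set.Ico x.1 x.2
    · rw [measure_biUnion_finset hd fun _ _ => measurableSet_Ico, Finset.mul_sum]
      refine (measure_biUnion_finset_le _ _).trans (Finset.sum_le_sum fun x hx => ?_)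
      rw [Real.volume_Ico, Real.volume_Ico, ← ENNReal.ofReal_mul (by linarith)]
      exact ENNReal.ofReal_le_ofReal (by linarith)
    · simp only [Set.PairwiseDisjoint, Set.Pairwise, not_forall, Finset.mem_coe] at hd
      obtain ⟨x, hx, y, hy, hxy, hnd⟩ := hd
      obtain ⟨z, hzx, hzy⟩ := Set.not_disjoint_iff.1 hnd
      simp only [Set.mem_Ico] at hzx hzy
      have hx' := hlt x hx
      have hy' := hlt y hy
      -- Two intersecting intervals are merged into their hull. The union does not grow, the dilated
      -- hull contains both dilations, and there is one interval less. Once all are disjoint,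
      -- subadditivity suffices.
      set u : ℝ × ℝ := (min x.1 y.1, max x.2 y.2) with hu
      set F' := insert u ((F.erase x).erase y) with hF'
      have hcard : F'.card ≤ N := by
        have h1 := Finset.card_erase_of_mem hx
        have h2 := Finset.card_erase_of_mem (Finset.mem_erase.2 ⟨hxy.symm, hy⟩)
        have h3 : 0 < (F.erase x).card :=
          Finset.card_pos.2 ⟨y, Finset.mem_erase.2 ⟨hxy.symm, hy⟩⟩
        have h4 : F'.card ≤ _ := Finset.card_insert_le u ((F.erase x).erase y)
        omega
      have hlt' : ∀ w ∈ F', w.1 < w.2 := by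
        intro w hw
        rcases Finset.mem_insert.1 hw with rfl | hw
        · exact (min_le_left _ _).trans_lt (hx'.trans_le (le_max_left _ _))
        · exact hlt w (Finset.mem_of_mem_erase (Finset.mem_of_mem_erase hw))
      have hsub : ∀ w ∈ F, ∃ w' ∈ F', w'.1 ≤ w.1 ∧ w.2 ≤ w'.2 := by
        intro w hw
        by_cases hwx : w = x
        · exact ⟨u, Finset.mem_insert_self _ _, hwx ▸ min_le_left _ _, hwx ▸ le_max_left _ _⟩
        by_cases hwy : w = y
        · exact ⟨u, Finset.mem_insert_self _ _, hwy ▸ min_le_right _ _, hwy ▸ le_max_right _ _⟩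
        · exact ⟨w, Finset.mem_insert_of_mem
            (Finset.mem_erase.2 ⟨hwy, Finset.mem_erase.2 ⟨hwx, hw⟩⟩), le_rfl, le_rfl⟩
      refine le_trans (measure_mono ?_) ((ih F' hcard hlt').trans ?_)
      · refine Set.iUnion₂_subset fun w hw => ?_
        obtain ⟨w', hw', h1, h2⟩ := hsub w hw
        refine subset_trans (Set.Ico_subset_Ico ?_ ?_)
          (Set.subset_biUnion_of_mem (u := fun x : ℝ × ℝ =>
            Set.Ico (x.1 - k * (x.2 - x.1)) (x.2 + k * (x.2 - x.1))) hw')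
        · nlinarith
        · nlinarith
      · gcongr 1
        refine measure_mono (Set.iUnion₂_subset fun w hw => ?_)
        rcases Finset.mem_insert.1 hw with rfl | hw
        · intro s hs
          simp only [hu, Set.mem_Ico, min_le_iff, lt_max_iff] at hs
          simp only [Set.mem_iUnion₂]
          rcases lt_or_ge s z with h | h
          · rcases hs.1 with h1 | h1
            · exact ⟨x, hx, h1, h.trans hzx.2⟩
            · exact ⟨y, hy, h1, h.trans hzy.2⟩
          · rcases hs.2 with h1 | h1
            · exact ⟨x, hx, hzx.1.trans h, h1⟩
            · exact ⟨y, hy, hzy.1.trans h, h1⟩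
        · exact Set.subset_biUnion_of_mem (u := fun x : ℝ × ℝ => Set.Ico x.1 x.2)
            (Finset.mem_of_mem_erase (Finset.mem_of_mem_erase hw))

lemma volume_biUnion_slots (T : Finset ℤ) :
    volume (⋃ t ∈ T, Set.Ico (t : ℝ) (t + 1)) = T.card := by
  rw [measure_biUnion_finset ((Set.pairwise_disjoint_Ico_intCast ℝ).set_pairwise _)
    fun _ _ => measurableSet_Ico]
  simp

lemma mem_slots_iff {T : Finset ℤ} {τ : ℝ} :
    τ ∈ ⋃ t ∈ T, Set.Ico (t : ℝ) (t + 1) ↔ ⌊τ⌋ ∈ T := by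
  simp only [Set.mem_iUnion₂]
  constructor
  · rintro ⟨t, ht, h⟩
    rwa [Int.floor_eq_iff.2 h]
  · exact fun h => ⟨_, h, Int.floor_le τ, Int.lt_floor_add_one τ⟩

/-- The YDS energy of `J'` is at most `(1 + 2 * k) ^ (α - 1)` times the energy of any feasible
schedule of `J`, if the window of every job in `J` lies in the dilation by the factor `1 + 2 * k`
of its window in `J'`. -/
lemma JobSet.yds_le_energy {n : ℕ} {J J' : JobSet n} (hJ : J.Valid) (hJ' : J'.Valid)
    (hvol : J'.volume = J.volume) {v : Fin n → ℝ} {C : Finset ℤ} (hY : J'.YDSSpec v C)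
    {k : ℝ} (hk : 0 ≤ k)
    (hleft : ∀ j, (J'.release j : ℝ) - k * ((J'.deadline j : ℝ) - J'.release j) ≤ J.release j)
    (hright : ∀ j,
      (J.deadline j : ℝ) ≤ J'.deadline j + k * ((J'.deadline j : ℝ) - J'.release j))
    {α : ℝ} (hα : 1 < α) {S : Schedule n} (hS : S.IsFeasible J) :
    ENNReal.ofReal (∑ t ∈ C, J'.ydsSpeed t ^ α) ≤
      ENNReal.ofReal ((1 + 2 * k) ^ (α - 1)) * S.energy α := by
  classical
  have hpq : α.HolderConjugate (α.conjExponent) := Real.HolderConjugate.conjExponent hα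
  set p := α.conjExponent
  obtain ⟨L, N, hLN⟩ := exists_cover J
  have hne : ∀ t : ℤ, (insert 0 ((Finset.univ.filter fun j => J.release j ≤ t ∧
      t < J.deadline j).image v)).Nonempty := fun t => Finset.insert_nonempty _ _
  -- The largest job speed over the windows of `J` containing `t`, with the default 0 if there are
  -- none; the job speeds themselves come from `J'`.
  set V : ℤ → ℝ := fun t => (insert 0 ((Finset.univ.filter fun j => J.release j ≤ t ∧
      t < J.deadline j).image v)).max' (hne t) with hV
  have hV0 : ∀ t, 0 ≤ V t := fun t => Finset.le_max' _ _ (Finset.mem_insert_self _ _)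
  have hVle : ∀ j, ∀ t ∈ Finset.Ico (J.release j) (J.deadline j), v j ≤ V t := by
    intro j t ht
    refine Finset.le_max' _ _ (Finset.mem_insert_of_mem (Finset.mem_image_of_mem _ ?_))
    simpa using ht
  have hVex : ∀ t θ, 0 < θ → θ ≤ V t →
      ∃ j, J.release j ≤ t ∧ t < J.deadline j ∧ θ ≤ v j := by
    intro t θ hθ h
    have h1 := Finset.max'_mem _ (hne t)
    rcases Finset.mem_insert.1 h1 with h1 | h1
    · exact absurd (hθ.trans_le h) (by rw [hV]; simp only [h1]; exact lt_irrefl _)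
    · obtain ⟨j, hj, hj'⟩ := Finset.mem_image.1 h1
      simp only [Finset.mem_filter, Finset.mem_univ, true_and] at hj
      exact ⟨j, hj.1, hj.2, h.trans_eq hj'.symm⟩
  have hs0 := hY.speed_nonneg
  -- For each level $\theta$, $\{V\ge\theta\}$ is covered by the dilated `J'`-windows of the jobs
  -- with $v_j\ge\theta$. Undilated, these windows lie in $\{s\ge\theta\}$ by `le_speed`.
  have hlevels : ∑ t ∈ Finset.Ico L N, V t ^ α ≤ (1 + 2 * k) * ∑ t ∈ C, J'.ydsSpeed t ^ α := by
    refine sum_rpow_le_of_card_levels C (Finset.Ico L N) (by linarith) (fun t _ => hs0 t)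
      (fun t _ => hV0 t) fun θ hθ => ?_
    set G : Finset (ℝ × ℝ) := (Finset.univ.filter fun j => θ ≤ v j).image
      fun j => ((J'.release j : ℝ), (J'.deadline j : ℝ)) with hG
    have hd := volume_biUnion_dilation_le k hk G.card G le_rfl (by
      intro x hx
      obtain ⟨j, -, rfl⟩ := Finset.mem_image.1 hx
      exact Int.cast_lt.2 (hJ'.lt j))
    have h1 : MeasureTheory.volume (⋃ t ∈ (Finset.Ico L N).filter fun t => θ ≤ V t,
        Set.Ico (t : ℝ) (t + 1)) ≤ ENNReal.ofReal (1 + 2 * k) *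
          MeasureTheory.volume (⋃ t ∈ C.filter fun t => θ ≤ J'.ydsSpeed t, Set.Ico (t : ℝ) (t + 1)) := by
      refine (measure_mono ?_).trans (hd.trans ?_)
      · intro τ hτ
        rw [mem_slots_iff, Finset.mem_filter] at hτ
        obtain ⟨j, hj1, hj2, hj3⟩ := hVex _ θ hθ hτ.2
        simp only [Set.mem_iUnion₂]
        refine ⟨_, Finset.mem_image_of_mem _ (Finset.mem_filter.2 ⟨Finset.mem_univ j, hj3⟩),
          (hleft j).trans (Int.le_floor.1 hj1), (Int.floor_lt.1 hj2).trans_le (hright j)⟩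
      · gcongr 1
        refine measure_mono (Set.iUnion₂_subset fun x hx τ hτ => ?_)
        obtain ⟨j, hj, rfl⟩ := Finset.mem_image.1 hx
        have hj' : θ ≤ v j := (Finset.mem_filter.1 hj).2
        have h2 : ⌊τ⌋ ∈ Finset.Ico (J'.release j) (J'.deadline j) :=
          Finset.mem_Ico.2 ⟨Int.le_floor.2 hτ.1, Int.floor_lt.2 hτ.2⟩
        have h3 := hj'.trans (hY.le_speed j _ h2)
        rw [mem_slots_iff, Finset.mem_filter]
        refine ⟨?_, h3⟩
        by_contra hc
        rw [hY.eq_zero _ hc] at h3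
        exact absurd hθ (not_lt.2 h3)
    rw [volume_biUnion_slots, volume_biUnion_slots] at h1
    have h2 := ENNReal.toReal_mono (ENNReal.mul_ne_top ENNReal.ofReal_ne_top
      (ENNReal.natCast_ne_top _)) h1
    rw [ENNReal.toReal_mul, ENNReal.toReal_ofReal (by linarith)] at h2
    simpa using h2
  have hmul : ∀ t, J'.ydsSpeed t * J'.ydsSpeed t ^ (α - 1) = J'.ydsSpeed t ^ α := by
    intro t
    rcases (hs0 t).eq_or_lt with h | h
    · rw [← h, zero_mul, Real.zero_rpow (by linarith)]
    · rw [mul_comm, ← Real.rpow_add_one h.ne', sub_add_cancel]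
  -- This exponent makes $\sum_j w_jv_j^{\alpha-1}$ the YDS energy.
  have hbal := hY.balance (α - 1)
  simp only [hmul, hvol] at hbal
  rw [← hbal]
  refine hS.le_energy hpq (T := Finset.Ico L N) (m := fun t => V t ^ (α - 1))
    (fun j => (hJ.pos j).le) (fun j => Real.rpow_nonneg (hY.pos_job j).le _)
    (fun t => Real.rpow_nonneg (hV0 t) _)
    (fun j => Finset.Ico_subset_Ico (hLN j).1 (hLN j).2) (fun j t ht => ?_) (by linarith) ?_
  · exact Real.rpow_le_rpow (hY.pos_job j).le (hVle j t ht) (by linarith)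
  · rw [hbal]
    refine le_of_eq_of_le (Finset.sum_congr rfl fun t _ => ?_) hlevels
    rw [← Real.rpow_mul (hV0 t), hpq.sub_one_mul_conj]

/-! ### The assignment of volumes -/

lemma rpow_tangent_le {x y α : ℝ} (hx : 0 ≤ x) (hy : 0 ≤ y) (hα : 1 < α) :
    α * x ^ (α - 1) * (y - x) ≤ y ^ α - x ^ α := by
  rcases hx.eq_or_lt with rfl | hx
  · rw [Real.zero_rpow (by linarith), Real.zero_rpow (by linarith)]
    have := Real.rpow_nonneg hy α
    linarith
  have h1 := one_add_mul_self_le_rpow_one_add (s := (y - x) / x) (by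
    rw [le_div_iff₀ hx]; linarith) hα.le
  have h2 : 1 + (y - x) / x = y / x := by field_simp; ring
  rw [h2, Real.div_rpow hy hx.le, le_div_iff₀ (Real.rpow_pos_of_pos hx α)] at h1
  have h3 : x ^ α = x ^ (α - 1) * x := by
    rw [← Real.rpow_add_one hx.ne', sub_add_cancel]
  have h4 : (1 + α * ((y - x) / x)) * x ^ α = x ^ α + α * x ^ (α - 1) * (y - x) := by
    rw [h3]; field_simp
  linarith

/-- Both $a+d$ and $b$ are convex combinations of $a$ and $b+d$, with interchanged weights; the two
convexity inequalities are added. -/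
lemma rpow_add_sub_le {a b d α : ℝ} (ha : 0 ≤ a) (hab : a ≤ b) (hd : 0 ≤ d) (hα : 1 ≤ α) :
    (a + d) ^ α - a ^ α ≤ (b + d) ^ α - b ^ α := by
  rcases hd.eq_or_lt with rfl | hd
  · simp
  have hu : 0 < b - a + d := by linarith
  have hc := (convexOn_rpow hα).2 (x := a) (y := b + d) ha (show 0 ≤ b + d by linarith)
  have h1 := hc (a := (b - a) / (b - a + d)) (b := d / (b - a + d))
    (div_nonneg (by linarith) hu.le) (div_nonneg hd.le hu.le) (by field_simp)
  have h2 := hc (a := d / (b - a + d)) (b := (b - a) / (b - a + d))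
    (div_nonneg hd.le hu.le) (div_nonneg (by linarith) hu.le) (by field_simp; ring)
  simp only [smul_eq_mul] at h1 h2
  have e1 : (b - a) / (b - a + d) * a + d / (b - a + d) * (b + d) = a + d := by
    field_simp; ring
  have e2 : d / (b - a + d) * a + (b - a) / (b - a + d) * (b + d) = b := by
    field_simp; ring
  rw [e1] at h1
  rw [e2] at h2
  have e3 : (b - a) / (b - a + d) * a ^ α + d / (b - a + d) * (b + d) ^ α +
      (d / (b - a + d) * a ^ α + (b - a) / (b - a + d) * (b + d) ^ α) =
      a ^ α + (b + d) ^ α := by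
    field_simp; ring
  linarith

/-- Water filling: the balanced distribution of one job over right parts with loads `V` and the
left parts. -/
lemma exists_waterFilling (T : Finset ℤ) (V : ℤ → ℝ) {δ l μ : ℝ} (hV : ∀ t, 0 ≤ V t)
    (hδ : 0 < δ) (hl : 0 ≤ l) :
    ∃ z : ℤ → ℝ, (∀ t ∉ T, z t = 0) ∧ (∀ t, 0 ≤ z t) ∧ (∀ t, z t ≤ δ) ∧
      (∀ t ∈ T, z t = 0 → μ * (T.card * δ - ∑ u ∈ T, z u) ≤ V t * l) ∧
      (∀ t ∈ T, 0 < z t → z t < δ → (V t + z t) * l = μ * (T.card * δ - ∑ u ∈ T, z u)) ∧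
      (∀ t ∈ T, z t = δ → (V t + z t) * l ≤ μ * (T.card * δ - ∑ u ∈ T, z u)) := by
  classical
  rcases hl.eq_or_lt with rfl | hl
  · refine ⟨fun t => if t ∈ T then δ else 0, fun t ht => if_neg ht, fun t => ?_, fun t => ?_,
      fun t ht h => ?_, fun t ht _ h => ?_, fun t ht _ => ?_⟩
    · dsimp only; split_ifs <;> linarith
    · dsimp only; split_ifs <;> linarith
    · simp only [if_pos ht] at h; linarith
    · simp only [if_pos ht] at h; linarith
    · rw [Finset.sum_congr rfl fun u hu => if_pos hu]; simp
  -- `c σ t` is the volume, clipped to $[0,\delta]$, that brings the right part to speed $\sigma$.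
  -- The continuous function `f` is what remains for the left parts minus what they process at speed
  -- $\sigma$; at a zero of `f` the speeds balance.
  set c : ℝ → ℤ → ℝ := fun σ t => max 0 (min δ (μ * σ - V t)) with hc
  set f : ℝ → ℝ := fun σ => T.card * δ - ∑ u ∈ T, c σ u - σ * l with hf
  have hcont : Continuous f := by
    simp only [hf, hc]
    fun_prop
  have hc0 : ∀ t, c 0 t = 0 := fun t => by
    rw [hc]
    simp only [mul_zero, zero_sub]
    exact max_eq_left (min_le_of_right_le (by linarith [hV t]))
  have hcnn : ∀ σ t, 0 ≤ c σ t := fun σ t => le_max_left _ _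
  set b := T.card * δ / l with hb
  have hb0 : 0 ≤ b := by positivity
  have h0 : 0 ≤ f 0 := by
    simp only [hf, hc0, Finset.sum_const_zero, sub_zero, zero_mul]
    positivity
  have h1 : f b ≤ 0 := by
    simp only [hf, hb, div_mul_cancel₀ _ hl.ne']
    linarith [Finset.sum_nonneg fun u (_ : u ∈ T) => hcnn b u]
  obtain ⟨σ, -, hσ⟩ := intermediate_value_Icc' hb0 hcont.continuousOn
    (Set.mem_Icc.2 ⟨h1, h0⟩)
  have hsum : ∑ u ∈ T, (if u ∈ T then c σ u else 0) = ∑ u ∈ T, c σ u :=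
    Finset.sum_congr rfl fun u hu => if_pos hu
  have hX : T.card * δ - ∑ u ∈ T, c σ u = σ * l := by
    simp only [hf] at hσ; linarith
  refine ⟨fun t => if t ∈ T then c σ t else 0, fun t ht => if_neg ht, fun t => ?_, fun t => ?_,
      fun t ht h => ?_, fun t ht h h' => ?_, fun t ht h => ?_⟩
  · dsimp only; split_ifs
    · exact hcnn σ t
    · exact le_rfl
  · dsimp only; split_ifs
    · exact max_le hδ.le (min_le_left _ _)
    · exact hδ.le
  · simp only [if_pos ht] at h
    have h2 : min δ (μ * σ - V t) ≤ 0 := (le_max_right _ _).trans_eq h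
    have h3 : μ * σ - V t ≤ 0 := by
      rcases min_le_iff.1 h2 with h | h
      · linarith
      · exact h
    rw [hsum, hX]
    nlinarith
  · simp only [if_pos ht] at h h'
    have h2 : c σ t = μ * σ - V t := by
      rcases max_choice 0 (min δ (μ * σ - V t)) with h3 | h3
      · exact absurd h3 h.ne'
      · rcases min_choice δ (μ * σ - V t) with h4 | h4
        · exact absurd (h3.trans h4) h'.ne
        · exact h3.trans h4
    simp only [if_pos ht]
    rw [hsum, hX, h2]
    ring
  · simp only [if_pos ht] at h
    have h2 : δ ≤ μ * σ - V t := by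
      rcases max_choice 0 (min δ (μ * σ - V t)) with h3 | h3
      · exact absurd (h.symm.trans h3) hδ.ne'
      · have h5 : δ ≤ min δ (μ * σ - V t) := (h.symm.trans h3).le
        exact h5.trans (min_le_right _ _)
    simp only [if_pos ht]
    rw [hsum, hX, h]
    nlinarith

namespace Instance

variable {n : ℕ} {I : Instance n} {lam μ α : ℝ} {y : Fin n → ℤ → ℝ}

lemma valid (I : Instance n) : I.toJobSet.Valid := ⟨I.release_lt_deadline, I.volume_pos⟩

lemma length_pos (I : Instance n) (j : Fin n) : 0 < (I.deadline j : ℝ) - I.release j := by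
  rw [sub_pos]; exact_mod_cast I.release_lt_deadline j

lemma density_pos (I : Instance n) (j : Fin n) : 0 < I.density j :=
  div_pos (I.volume_pos j) (I.length_pos j)

lemma card_mul_density (I : Instance n) (j : Fin n) :
    ((Finset.Ico (I.release j) (I.deadline j)).card : ℝ) * I.density j = I.volume j := by
  have h1 : (((Finset.Ico (I.release j) (I.deadline j)).card : ℕ) : ℝ) =
      (I.deadline j : ℝ) - I.release j := by
    rw [Int.card_Ico]
    have h3 : (((I.deadline j - I.release j).toNat : ℕ) : ℤ) = I.deadline j - I.release j :=
      Int.toNat_of_nonneg (by linarith [I.release_lt_deadline j])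
    exact_mod_cast congrArg (fun z : ℤ => (z : ℝ)) h3
  rw [h1, density, mul_div_cancel₀ _ (I.length_pos j).ne']

lemma shrunk_valid (I : Instance n) (hlam : lam < 1 / 2) : (I.shrunk lam).Valid := by
  refine ⟨fun j => ?_, I.volume_pos⟩
  have h1 := I.pred_lt j
  have h2 := Int.floor_le (I.predRelease j + lam * (I.predDeadline j - I.predRelease j))
  have h3 := Int.le_ceil (I.predDeadline j - lam * (I.predDeadline j - I.predRelease j))
  have h4 : ((I.shrunk lam).release j : ℝ) < ((I.shrunk lam).deadline j : ℝ) := by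
    simp only [shrunk]
    nlinarith
  exact_mod_cast h4

lemma reserved_eq (j : Fin n) : I.reserved lam μ j =
    (1 - μ) * ∑ t ∈ Finset.Ico (I.release j) (I.deadline j),
      ((I.shrunk lam).ydsHi t j - (I.shrunk lam).ydsLo t j) := by
  rw [reserved, Finset.mul_sum]
  exact Finset.sum_congr rfl fun t _ => by ring

lemma reserved_nonneg (hS : (I.shrunk lam).SlotSpec) (hμ : μ ≤ 1) (j : Fin n) :
    0 ≤ I.reserved lam μ j := by
  rw [reserved_eq]
  exact mul_nonneg (by linarith) (Finset.sum_nonneg fun t _ => sub_nonneg.2 (hS.lo_le_hi t j))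

/-- The first `k` jobs have been assigned. -/
lemma exists_partial_assignment (hl : ∀ j, 0 ≤ I.reserved lam μ j) (k : ℕ) :
    k ≤ n → ∃ y : Fin n → ℤ → ℝ, (∀ j t, 0 ≤ y j t) ∧ ∀ j : Fin n, j.val < k →
      (∀ t ∉ Finset.Ico (I.release j) (I.deadline j), y j t = 0) ∧
      (∀ t, y j t ≤ I.density j) ∧
      (∀ t ∈ Finset.Ico (I.release j) (I.deadline j), y j t = 0 →
        μ * I.leftVolume y j ≤ rightLoad y t j * I.reserved lam μ j) ∧
      (∀ t ∈ Finset.Ico (I.release j) (I.deadline j), 0 < y j t → y j t < I.density j →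
        (rightLoad y t j + y j t) * I.reserved lam μ j = μ * I.leftVolume y j) ∧
      (∀ t ∈ Finset.Ico (I.release j) (I.deadline j), y j t = I.density j →
        (rightLoad y t j + y j t) * I.reserved lam μ j ≤ μ * I.leftVolume y j) := by
  induction k with
  | zero => exact fun _ => ⟨fun _ _ => 0, fun _ _ => le_rfl, fun j hj => absurd hj (by omega)⟩
  | succ k ih =>
    intro hk
    obtain ⟨y, hy0, hy⟩ := ih (by omega)
    set i : Fin n := ⟨k, hk⟩ with hi
    obtain ⟨z, hz1, hz2, hz3, hz4, hz5, hz6⟩ := exists_waterFilling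
      (Finset.Ico (I.release i) (I.deadline i)) (fun t => rightLoad y t i)
      (fun t => Finset.sum_nonneg fun j _ => hy0 j t) (I.density_pos i) (hl i)
    rw [I.card_mul_density i] at hz4 hz5 hz6
    -- The load seen by a job involves only smaller indices, so assigning job `k` does not disturb
    -- the earlier conditions.
    have hload : ∀ j : Fin n, j.val ≤ k → ∀ t,
        rightLoad (Function.update y i z) t j = rightLoad y t j := by
      intro j hj t
      refine Finset.sum_congr rfl fun i' hi' => ?_
      have h1 : i' ≠ i := by
        rintro rfl
        have := (Finset.mem_filter.1 hi').2
        rw [Fin.lt_def] at this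
        simp only [hi] at this
        omega
      rw [Function.update_of_ne h1]
    refine ⟨Function.update y i z, fun j t => ?_, fun j hj => ?_⟩
    · by_cases h : j = i
      · subst h; rw [Function.update_self]; exact hz2 t
      · rw [Function.update_of_ne h]; exact hy0 j t
    · simp only [leftVolume, hload j (by omega)]
      by_cases h : j = i
      · subst h
        rw [Function.update_self]
        exact ⟨hz1, hz3, hz4, hz5, hz6⟩
      · rw [Function.update_of_ne h]
        refine hy j ?_
        have : j.val ≠ k := fun hc => h (Fin.ext hc)
        omega

lemma exists_assignment (hl : ∀ j, 0 ≤ I.reserved lam μ j) :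
    ∃ y, I.IsSwPAssignment lam μ y := by
  obtain ⟨y, hy0, hy⟩ := exists_partial_assignment hl n le_rfl
  exact ⟨y, fun j => (hy j j.2).1, fun j t _ => hy0 j t, fun j t _ => (hy j j.2).2.1 t,
    fun j => (hy j j.2).2.2.1, fun j => (hy j j.2).2.2.2.1, fun j => (hy j j.2).2.2.2.2⟩

namespace IsSwPAssignment

lemma y_nonneg (hy : I.IsSwPAssignment lam μ y) (j : Fin n) (t : ℤ) : 0 ≤ y j t := by
  by_cases ht : t ∈ Finset.Ico (I.release j) (I.deadline j)
  · exact hy.nonneg j t ht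
  · exact (hy.outside j t ht).ge

lemma rightLoad_nonneg (hy : I.IsSwPAssignment lam μ y) (t : ℤ) (j : Fin n) :
    0 ≤ rightLoad y t j :=
  Finset.sum_nonneg fun i _ => hy.y_nonneg i t

lemma leftVolume_eq (I : Instance n) (y : Fin n → ℤ → ℝ) (j : Fin n) :
    I.leftVolume y j =
      ∑ t ∈ Finset.Ico (I.release j) (I.deadline j), (I.density j - y j t) := by
  rw [Finset.sum_sub_distrib, Finset.sum_const, nsmul_eq_mul, card_mul_density, leftVolume]

lemma leftVolume_nonneg (hy : I.IsSwPAssignment lam μ y) (j : Fin n) :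
    0 ≤ I.leftVolume y j := by
  rw [leftVolume_eq]
  exact Finset.sum_nonneg fun t ht => sub_nonneg.2 (hy.le_density j t ht)

/-- If no time is reserved for `j`, then all its volume goes to the right parts. -/
lemma eq_density (hy : I.IsSwPAssignment lam μ y) (hμ : 0 < μ) {j : Fin n}
    (hl : I.reserved lam μ j = 0) {t : ℤ} (ht : t ∈ Finset.Ico (I.release j) (I.deadline j)) :
    y j t = I.density j := by
  have hX := hy.leftVolume_nonneg j
  have hX0 : I.leftVolume y j = 0 → y j t = I.density j := by
    intro h
    rw [leftVolume_eq, Finset.sum_eq_zero_iff_of_nonneg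
      fun t ht => sub_nonneg.2 (hy.le_density j t ht)] at h
    linarith [h t ht]
  rcases (hy.le_density j t ht).eq_or_lt with h | h
  · exact h
  rcases (hy.nonneg j t ht).eq_or_lt with h' | h'
  · have := hy.empty j t ht h'.symm
    rw [hl, mul_zero] at this
    exact hX0 (le_antisymm (nonpos_of_mul_nonpos_right this hμ) hX)
  · have := hy.between j t ht h' h
    rw [hl, mul_zero] at this
    exact hX0 ((mul_eq_zero.1 this.symm).resolve_left hμ.ne')

lemma leftVolume_eq_zero (hy : I.IsSwPAssignment lam μ y) (hμ : 0 < μ) {j : Fin n}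
    (hl : I.reserved lam μ j = 0) : I.leftVolume y j = 0 := by
  rw [leftVolume_eq]
  exact Finset.sum_eq_zero fun t ht => by rw [hy.eq_density hμ hl ht, sub_self]

/-- For $\mu=0$ a positive volume would give $(V_t+y_j^t)\,\ell(j)\le 0$ with both factors positive.
This keeps the conventions for division by $\mu=0$ harmless. -/
lemma eq_zero_of_mu_eq_zero (hy : I.IsSwPAssignment lam 0 y) {j : Fin n}
    (hl : 0 < I.reserved lam 0 j) (t : ℤ) : y j t = 0 := by
  by_cases ht : t ∈ Finset.Ico (I.release j) (I.deadline j)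
  swap
  · exact hy.outside j t ht
  by_contra h
  have h0 : 0 < y j t := lt_of_le_of_ne (hy.nonneg j t ht) (Ne.symm h)
  have h1 : (rightLoad y t j + y j t) * I.reserved lam 0 j ≤ 0 := by
    rcases (hy.le_density j t ht).eq_or_lt with h2 | h2
    · have := hy.full j t ht h2
      linarith
    · have := hy.between j t ht h0 h2
      linarith
  have h2 := mul_pos (add_pos_of_nonneg_of_pos (hy.rightLoad_nonneg t j) h0) hl
  linarith

lemma rightSpeed_le (hy : I.IsSwPAssignment lam μ y) (hμ : 0 ≤ μ) {j : Fin n}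
    (hl : 0 < I.reserved lam μ j) {t : ℤ} (ht : t ∈ Finset.Ico (I.release j) (I.deadline j))
    (h0 : 0 < y j t) :
    (rightLoad y t j + y j t) / μ ≤ I.leftVolume y j / I.reserved lam μ j := by
  rcases hμ.eq_or_lt with rfl | hμ
  · exact absurd (hy.eq_zero_of_mu_eq_zero hl t) h0.ne'
  rw [div_le_div_iff₀ hμ hl, mul_comm (I.leftVolume y j)]
  rcases (hy.le_density j t ht).eq_or_lt with h | h
  · exact hy.full j t ht h
  · exact (hy.between j t ht h0 h).le

lemma le_rightSpeed (hy : I.IsSwPAssignment lam μ y) (hμ : 0 < μ) {j : Fin n}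
    (hl : 0 < I.reserved lam μ j) {t : ℤ} (ht : t ∈ Finset.Ico (I.release j) (I.deadline j))
    (h0 : y j t < I.density j) :
    I.leftVolume y j / I.reserved lam μ j ≤ (rightLoad y t j + y j t) / μ := by
  rw [div_le_div_iff₀ hl hμ, mul_comm (I.leftVolume y j)]
  rcases (hy.nonneg j t ht).eq_or_lt with h | h
  · have := hy.empty j t ht h.symm
    rwa [← h, add_zero]
  · exact (hy.between j t ht h h0).ge

/-- The cost of `j` is at most that of putting all its volume on the right parts. -/
lemma cost_le_right (hy : I.IsSwPAssignment lam μ y) (hμ : 0 < μ) (hα : 1 < α) (j : Fin n)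
    (hl : 0 ≤ I.reserved lam μ j) :
    I.reserved lam μ j * (I.leftVolume y j / I.reserved lam μ j) ^ α +
      ∑ t ∈ Finset.Ico (I.release j) (I.deadline j), μ * ((rightLoad y t j + y j t) / μ) ^ α ≤
    ∑ t ∈ Finset.Ico (I.release j) (I.deadline j), μ * ((rightLoad y t j + I.density j) / μ) ^ α
      := by
  rcases hl.eq_or_lt with hl | hl
  · rw [← hl, zero_mul, zero_add]
    exact Finset.sum_le_sum fun t ht => by rw [hy.eq_density hμ hl.symm ht]
  set σ := I.leftVolume y j / I.reserved lam μ j with hσ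
  have hσ0 : 0 ≤ σ := div_nonneg (hy.leftVolume_nonneg j) hl.le
  have hX : I.leftVolume y j = I.reserved lam μ j * σ := by
    rw [hσ, mul_div_cancel₀ _ hl.ne']
  -- Where $y_j^t<\delta_j$ the right part is at least as fast as $\sigma$, so by the tangent
  -- inequality each further unit of volume there costs at least $\alpha\sigma^{\alpha-1}$. Moving
  -- all of $X_j=\ell\sigma$ costs at least $\alpha\ell\sigma^\alpha$, more than the
  -- $\ell\sigma^\alpha$ saved on the left.
  have h1 : ∀ t ∈ Finset.Ico (I.release j) (I.deadline j),
      α * σ ^ (α - 1) * (I.density j - y j t) + μ * ((rightLoad y t j + y j t) / μ) ^ α ≤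
        μ * ((rightLoad y t j + I.density j) / μ) ^ α := by
    intro t ht
    have hV := hy.rightLoad_nonneg t j
    have hy0 := hy.nonneg j t ht
    rcases (hy.le_density j t ht).eq_or_lt with h | h
    · rw [h, sub_self, mul_zero, zero_add]
    have h2 := rpow_tangent_le (x := (rightLoad y t j + y j t) / μ)
      (y := (rightLoad y t j + I.density j) / μ) (by positivity)
      (div_nonneg (add_nonneg hV (I.density_pos j).le) hμ.le) hα
    have h3 : σ ^ (α - 1) ≤ ((rightLoad y t j + y j t) / μ) ^ (α - 1) :=
      Real.rpow_le_rpow hσ0 (hy.le_rightSpeed hμ hl ht h) (by linarith)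
    have h4 : (rightLoad y t j + I.density j) / μ - (rightLoad y t j + y j t) / μ =
        (I.density j - y j t) / μ := by ring
    rw [h4] at h2
    have h5 : α * σ ^ (α - 1) * ((I.density j - y j t) / μ) ≤
        α * ((rightLoad y t j + y j t) / μ) ^ (α - 1) * ((I.density j - y j t) / μ) := by
      have : 0 ≤ (I.density j - y j t) / μ := div_nonneg (by linarith) hμ.le
      gcongr
    have h6 := mul_le_mul_of_nonneg_left (h5.trans h2) hμ.le
    have h7 : μ * (α * σ ^ (α - 1) * ((I.density j - y j t) / μ)) =
        α * σ ^ (α - 1) * (I.density j - y j t) := by field_simp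
    linarith
  have h2 := Finset.sum_le_sum h1
  rw [Finset.sum_add_distrib, ← Finset.mul_sum, ← leftVolume_eq, hX] at h2
  refine le_trans (add_le_add ?_ le_rfl) h2
  rcases hσ0.eq_or_lt with h | h
  · rw [← h, Real.zero_rpow (by linarith)]; simp
  · have h3 : σ ^ α = σ ^ (α - 1) * σ := by rw [← Real.rpow_add_one h.ne', sub_add_cancel]
    have h4 : 0 ≤ I.reserved lam μ j * σ ^ α := by positivity
    have h5 : α * σ ^ (α - 1) * (I.reserved lam μ j * σ) = α * (I.reserved lam μ j * σ ^ α) := by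
      rw [h3]; ring
    rw [h5]
    nlinarith

/-- The cost of `j` is at most that of putting all its volume on the left parts. -/
lemma cost_le_left (hy : I.IsSwPAssignment lam μ y) (hμ : 0 ≤ μ) (hα : 1 < α) (j : Fin n)
    (hl : 0 < I.reserved lam μ j) :
    I.reserved lam μ j * (I.leftVolume y j / I.reserved lam μ j) ^ α +
      ∑ t ∈ Finset.Ico (I.release j) (I.deadline j), μ * ((rightLoad y t j + y j t) / μ) ^ α ≤
    I.reserved lam μ j * (I.volume j / I.reserved lam μ j) ^ α +
      ∑ t ∈ Finset.Ico (I.release j) (I.deadline j), μ * (rightLoad y t j / μ) ^ α := by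
  set σ := I.leftVolume y j / I.reserved lam μ j with hσ
  have hσ0 : 0 ≤ σ := div_nonneg (hy.leftVolume_nonneg j) hl.le
  -- Where $y_j^t>0$ the right part is at most as fast as $\sigma$, so each unit there costs at most
  -- $\alpha\sigma^{\alpha-1}$. Taking it back to the left parts costs at least that much, by the
  -- tangent at $\sigma$ in `h3` below.
  have h1 : ∀ t ∈ Finset.Ico (I.release j) (I.deadline j),
      μ * ((rightLoad y t j + y j t) / μ) ^ α ≤
        μ * (rightLoad y t j / μ) ^ α + α * σ ^ (α - 1) * y j t := by
    intro t ht
    have hV := hy.rightLoad_nonneg t j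
    rcases (hy.nonneg j t ht).eq_or_lt with h | h
    · rw [← h]; simp
    rcases hμ.eq_or_lt with rfl | hμ
    · exact absurd (hy.eq_zero_of_mu_eq_zero hl t) h.ne'
    have h2 := rpow_tangent_le (x := (rightLoad y t j + y j t) / μ)
      (y := rightLoad y t j / μ) (by positivity) (by positivity) hα
    have h3 : ((rightLoad y t j + y j t) / μ) ^ (α - 1) ≤ σ ^ (α - 1) :=
      Real.rpow_le_rpow (by positivity) (hy.rightSpeed_le hμ.le hl ht h) (by linarith)
    have h4 : rightLoad y t j / μ - (rightLoad y t j + y j t) / μ = - (y j t / μ) := by ring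
    rw [h4] at h2
    have h5 : α * ((rightLoad y t j + y j t) / μ) ^ (α - 1) * (y j t / μ) ≤
        α * σ ^ (α - 1) * (y j t / μ) := by gcongr
    have h6 : μ * (α * σ ^ (α - 1) * (y j t / μ)) = α * σ ^ (α - 1) * y j t := by field_simp
    have h7 : ((rightLoad y t j + y j t) / μ) ^ α - (rightLoad y t j / μ) ^ α ≤
      α * σ ^ (α - 1) * (y j t / μ) := by linarith
    have h8 := mul_le_mul_of_nonneg_left h7 hμ.le
    linarith
  have h2 := Finset.sum_le_sum h1
  rw [Finset.sum_add_distrib, ← Finset.mul_sum _ _ (α * σ ^ (α - 1))] at h2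
  have h3 := rpow_tangent_le (x := σ) (y := I.volume j / I.reserved lam μ j) hσ0
    (div_nonneg (I.volume_pos j).le hl.le) hα
  have h4 : I.volume j / I.reserved lam μ j - σ =
      (∑ t ∈ Finset.Ico (I.release j) (I.deadline j), y j t) / I.reserved lam μ j := by
    rw [hσ, leftVolume]; ring
  rw [h4] at h3
  have h5 := mul_le_mul_of_nonneg_left h3 hl.le
  have h6 : I.reserved lam μ j * (α * σ ^ (α - 1) *
      ((∑ t ∈ Finset.Ico (I.release j) (I.deadline j), y j t) / I.reserved lam μ j)) =
      α * σ ^ (α - 1) * ∑ t ∈ Finset.Ico (I.release j) (I.deadline j), y j t := by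
    field_simp
  linarith

/-! ### The total cost, as a sum of increments in order of arrival. -/

/-- The cost of the left parts and of the right parts of all slots. -/
noncomputable def cost (I : Instance n) (lam μ α : ℝ) (y : Fin n → ℤ → ℝ) (L N : ℤ) : ℝ :=
  ∑ j, I.reserved lam μ j * (I.leftVolume y j / I.reserved lam μ j) ^ α +
    ∑ t ∈ Finset.Ico L N, μ * ((∑ j, y j t) / μ) ^ α

lemma sum_increments (y : Fin n → ℤ → ℝ) (hα : 1 < α) (L N : ℤ) :
    ∑ j, ∑ t ∈ Finset.Ico L N,
        (μ * ((rightLoad y t j + y j t) / μ) ^ α - μ * (rightLoad y t j / μ) ^ α) =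
      ∑ t ∈ Finset.Ico L N, μ * ((∑ j, y j t) / μ) ^ α := by
  rw [Finset.sum_comm]
  refine Finset.sum_congr rfl fun t _ => ?_
  have := sum_telescope (id : Fin n → Fin n) Function.injective_id (fun j => y j t)
    fun x => μ * (x / μ) ^ α
  simp only [zero_div, Real.zero_rpow (by linarith : α ≠ 0), mul_zero, sub_zero, id] at this
  exact this

lemma sum_increments_window {y : Fin n → ℤ → ℝ} {L N : ℤ} {j : Fin n}
    (hy : ∀ t ∉ Finset.Ico (I.release j) (I.deadline j), y j t = 0)
    (hLN : L ≤ I.release j ∧ I.deadline j ≤ N) :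
    ∑ t ∈ Finset.Ico L N,
        (μ * ((rightLoad y t j + y j t) / μ) ^ α - μ * (rightLoad y t j / μ) ^ α) =
      ∑ t ∈ Finset.Ico (I.release j) (I.deadline j), μ * ((rightLoad y t j + y j t) / μ) ^ α -
        ∑ t ∈ Finset.Ico (I.release j) (I.deadline j), μ * (rightLoad y t j / μ) ^ α := by
  rw [← Finset.sum_sub_distrib]
  refine (Finset.sum_subset (Finset.Ico_subset_Ico hLN.1 hLN.2) fun t _ ht => ?_).symm
  rw [hy t ht, add_zero, sub_self]

/-- Each job is compared with its AVR share `x`. By `cost_le_right` its increment is at most that of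
adding $\delta_j$ to the loads of `y`. Since $y\le x$, convexity bounds this by the increment on top
of the larger AVR loads, and those increments telescope. -/
lemma cost_le_avr (hy : I.IsSwPAssignment lam μ y) (hμ : 0 < μ) (hα : 1 < α)
    (hl : ∀ j, 0 ≤ I.reserved lam μ j) {L N : ℤ}
    (hLN : ∀ j, L ≤ I.release j ∧ I.deadline j ≤ N) :
    cost I lam μ α y L N ≤
      (1 / μ) ^ (α - 1) * ∑ t ∈ Finset.Ico L N, I.toJobSet.avrSpeed t ^ α := by
  classical
  set x : Fin n → ℤ → ℝ := fun j t =>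
    if t ∈ Finset.Ico (I.release j) (I.deadline j) then I.density j else 0 with hx
  have hyx : ∀ j t, y j t ≤ x j t := by
    intro j t
    simp only [hx]
    split_ifs with h
    · exact hy.le_density j t h
    · exact (hy.outside j t h).le
  have hxs : ∀ t, ∑ j, x j t = I.toJobSet.avrSpeed t := by
    intro t
    rw [JobSet.avrSpeed, Finset.sum_filter]
    exact Finset.sum_congr rfl fun j _ => by simp only [hx, Finset.mem_Ico, density]
  have hμx : ∀ t, μ * ((∑ j, x j t) / μ) ^ α =
      (1 / μ) ^ (α - 1) * I.toJobSet.avrSpeed t ^ α := by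
    intro t
    rw [hxs, Real.div_rpow (I.toJobSet.avrSpeed_nonneg I.valid t) hμ.le, one_div,
      Real.inv_rpow hμ.le, Real.rpow_sub_one hμ.ne']
    have := (Real.rpow_pos_of_pos hμ α).ne'
    field_simp
  rw [Finset.mul_sum, ← Finset.sum_congr rfl fun t _ => hμx t, ← sum_increments x hα, cost,
    ← sum_increments y hα, ← Finset.sum_add_distrib]
  refine Finset.sum_le_sum fun j _ => ?_
  rw [sum_increments_window (hy.outside j) (hLN j),
    sum_increments_window (I := I) (fun t ht => by simp only [hx, if_neg ht]) (hLN j)]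
  have h1 := hy.cost_le_right hμ hα j (hl j)
  have h2 : ∀ t ∈ Finset.Ico (I.release j) (I.deadline j),
      μ * ((rightLoad y t j + I.density j) / μ) ^ α - μ * (rightLoad y t j / μ) ^ α ≤
      μ * ((rightLoad x t j + x j t) / μ) ^ α - μ * (rightLoad x t j / μ) ^ α := by
    intro t ht
    have hxt : x j t = I.density j := if_pos ht
    rw [hxt, ← mul_sub, ← mul_sub, add_div, add_div]
    refine mul_le_mul_of_nonneg_left (rpow_add_sub_le
      (div_nonneg (hy.rightLoad_nonneg t j) hμ.le) ?_
      (div_nonneg (I.density_pos j).le hμ.le) hα.le) hμ.le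
    exact div_le_div_of_nonneg_right (Finset.sum_le_sum fun i _ => hyx i t) hμ.le
  have h3 := Finset.sum_le_sum h2
  rw [Finset.sum_sub_distrib, Finset.sum_sub_distrib] at h3
  linarith

lemma cost_le_reserved (hy : I.IsSwPAssignment lam μ y) (hμ : 0 ≤ μ) (hα : 1 < α)
    (hl : ∀ j, 0 < I.reserved lam μ j) {L N : ℤ}
    (hLN : ∀ j, L ≤ I.release j ∧ I.deadline j ≤ N) :
    cost I lam μ α y L N ≤
      ∑ j, I.reserved lam μ j * (I.volume j / I.reserved lam μ j) ^ α := by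
  rw [cost, ← sum_increments y hα, ← Finset.sum_add_distrib]
  refine Finset.sum_le_sum fun j _ => ?_
  rw [sum_increments_window (hy.outside j) (hLN j)]
  linarith [hy.cost_le_left hμ hα j (hl j)]

end IsSwPAssignment

/-! ### Accurate predictions -/

lemma predError_nonneg (I : Instance n) : 0 ≤ I.predError :=
  Real.iSup_nonneg fun j => le_max_of_le_left
    (div_nonneg (abs_nonneg _) (sub_nonneg.2 (I.pred_lt j).le))

lemma abs_sub_le_predError (I : Instance n) (j : Fin n) :
    |I.predRelease j - I.release j| ≤ I.predError * (I.predDeadline j - I.predRelease j) ∧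
      |I.predDeadline j - I.deadline j| ≤
        I.predError * (I.predDeadline j - I.predRelease j) := by
  have hL : 0 < I.predDeadline j - I.predRelease j := sub_pos.2 (I.pred_lt j)
  rw [← div_le_iff₀ hL, ← div_le_iff₀ hL]
  have h := le_ciSup (f := fun j =>
    max (|I.predRelease j - I.release j| / (I.predDeadline j - I.predRelease j))
      (|I.predDeadline j - I.deadline j| / (I.predDeadline j - I.predRelease j)))
    (Set.finite_range _).bddAbove j
  exact max_le_iff.1 h

/-- The windows of the shrunk predicted jobs lie in the true windows. -/
lemma shrunk_window (I : Instance n) (h : I.predError ≤ lam) (j : Fin n) :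
    I.release j ≤ (I.shrunk lam).release j ∧ (I.shrunk lam).deadline j ≤ I.deadline j := by
  have hL : 0 < I.predDeadline j - I.predRelease j := sub_pos.2 (I.pred_lt j)
  obtain ⟨h1, h2⟩ := I.abs_sub_le_predError j
  have h3 := mul_le_mul_of_nonneg_right h hL.le
  rw [abs_le] at h1 h2
  exact ⟨Int.le_floor.2 (by linarith), Int.ceil_le.2 (by linarith)⟩

/-- The true windows lie in dilations of the windows of the shrunk predicted jobs. -/
lemma window_subset_dilation (I : Instance n) (hlam₀ : 0 ≤ lam) (hlam : lam < 1 / 2)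
    (j : Fin n) :
    ((I.shrunk lam).release j : ℝ) - (lam + I.predError) / (1 - 2 * lam) *
        (((I.shrunk lam).deadline j : ℝ) - (I.shrunk lam).release j) ≤ I.release j ∧
      (I.deadline j : ℝ) ≤ (I.shrunk lam).deadline j + (lam + I.predError) / (1 - 2 * lam) *
        (((I.shrunk lam).deadline j : ℝ) - (I.shrunk lam).release j) := by
  have hk : 0 ≤ (lam + I.predError) / (1 - 2 * lam) :=
    div_nonneg (add_nonneg hlam₀ I.predError_nonneg) (by linarith)
  obtain ⟨h1, h2⟩ := I.abs_sub_le_predError j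
  have h3 : ((I.shrunk lam).release j : ℝ) ≤ _ :=
    Int.floor_le (I.predRelease j + lam * (I.predDeadline j - I.predRelease j))
  have h4 : _ ≤ ((I.shrunk lam).deadline j : ℝ) :=
    Int.le_ceil (I.predDeadline j - lam * (I.predDeadline j - I.predRelease j))
  -- Outward rounding only lengthens the shrunk window. Each true endpoint exceeds the shrunk one by
  -- at most $(\lambda+\eta)(q_j-p_j)$, hence by at most $(\lambda+\eta)/(1-2\lambda)$ shrunk
  -- lengths.
  have h5 : (1 - 2 * lam) * (I.predDeadline j - I.predRelease j) ≤
      ((I.shrunk lam).deadline j : ℝ) - (I.shrunk lam).release j := by linarith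
  have h6 := mul_le_mul_of_nonneg_left h5 hk
  rw [← mul_assoc, div_mul_cancel₀ _ (by linarith)] at h6
  rw [abs_le] at h1 h2
  constructor <;> linarith

/-- The condition $\eta\le\lambda$ acts only here: the shrunk window lies in the true one, so YDS
does the whole of $j$ in slots where SwP may use the reservation. -/
lemma volume_le_ydsWork (hS : (I.shrunk lam).SlotSpec) (hs : ∀ t, 0 ≤ (I.shrunk lam).ydsSpeed t)
    (h : I.predError ≤ lam) (j : Fin n) :
    I.volume j ≤ ∑ t ∈ Finset.Ico (I.release j) (I.deadline j),
      ((I.shrunk lam).ydsHi t j - (I.shrunk lam).ydsLo t j) * (I.shrunk lam).ydsSpeed t := by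
  have h1 : (I.shrunk lam).volume j = I.volume j := rfl
  rw [← h1, ← hS.complete j]
  obtain ⟨h2, h3⟩ := I.shrunk_window h j
  exact Finset.sum_le_sum_of_subset_of_nonneg (Finset.Ico_subset_Ico h2 h3)
    fun t _ _ => mul_nonneg (sub_nonneg.2 (hS.lo_le_hi t j)) (hs t)

lemma sum_ydsTime_pos (hS : (I.shrunk lam).SlotSpec)
    (hs : ∀ t, 0 ≤ (I.shrunk lam).ydsSpeed t) (h : I.predError ≤ lam) (j : Fin n) :
    0 < ∑ t ∈ Finset.Ico (I.release j) (I.deadline j),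
      ((I.shrunk lam).ydsHi t j - (I.shrunk lam).ydsLo t j) := by
  have h0 : ∀ t, 0 ≤ (I.shrunk lam).ydsHi t j - (I.shrunk lam).ydsLo t j := fun t =>
    sub_nonneg.2 (hS.lo_le_hi t j)
  refine lt_of_le_of_ne (Finset.sum_nonneg fun t _ => h0 t) fun hc => ?_
  have h1 := (Finset.sum_eq_zero_iff_of_nonneg fun t _ => h0 t).1 hc.symm
  have h2 := volume_le_ydsWork hS hs h j
  rw [Finset.sum_eq_zero fun t ht => by rw [h1 t ht, zero_mul]] at h2
  exact absurd (I.volume_pos j) (not_lt.2 h2)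

lemma reserved_pos (hS : (I.shrunk lam).SlotSpec)
    (hs : ∀ t, 0 ≤ (I.shrunk lam).ydsSpeed t) (h : I.predError ≤ lam) (hμ : μ < 1) (j : Fin n) :
    0 < I.reserved lam μ j := by
  rw [reserved_eq]
  exact mul_pos (by linarith) (sum_ydsTime_pos hS hs h j)

/-- Running all jobs in their reserved time costs at most the energy of the compressed YDS
schedule. -/
lemma sum_reserved_le_yds {v : Fin n → ℝ} {C : Finset ℤ} (hY : (I.shrunk lam).YDSSpec v C)
    (hS : (I.shrunk lam).SlotSpec) (h : I.predError ≤ lam) (hμ : μ < 1) (hα : 1 < α) :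
    ∑ j, I.reserved lam μ j * (I.volume j / I.reserved lam μ j) ^ α ≤
      (1 / (1 - μ)) ^ (α - 1) * ∑ t ∈ C, (I.shrunk lam).ydsSpeed t ^ α := by
  classical
  have hs := hY.speed_nonneg
  set s := (I.shrunk lam).ydsSpeed with hsdef
  set τ : ℤ → Fin n → ℝ := fun t j =>
    (I.shrunk lam).ydsHi t j - (I.shrunk lam).ydsLo t j with hτ
  have hτ0 : ∀ t j, 0 ≤ τ t j := fun t j => sub_nonneg.2 (hS.lo_le_hi t j)
  have hμ' : 0 < 1 - μ := by linarith
  have hjob : ∀ j, I.reserved lam μ j * (I.volume j / I.reserved lam μ j) ^ α ≤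
      (1 / (1 - μ)) ^ (α - 1) * ∑ t ∈ C, τ t j * s t ^ α := by
    intro j
    set T := ∑ t ∈ Finset.Ico (I.release j) (I.deadline j), τ t j with hT
    have hTpos : 0 < T := sum_ydsTime_pos hS hs h j
    set W := ∑ t ∈ Finset.Ico (I.release j) (I.deadline j), τ t j * s t with hW
    have hwW : I.volume j ≤ W := volume_le_ydsWork hS hs h j
    have hWpos : 0 < W := (I.volume_pos j).trans_le hwW
    have hres : I.reserved lam μ j = (1 - μ) * T := reserved_eq j
    set x := W / T with hx
    have hx0 : 0 < x := div_pos hWpos hTpos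
    have h1 : I.reserved lam μ j * (I.volume j / I.reserved lam μ j) ^ α ≤
        (1 / (1 - μ)) ^ (α - 1) * (T * x ^ α) := by
      have h2 : I.volume j / I.reserved lam μ j ≤ 1 / (1 - μ) * x := by
        rw [hres, hx, div_mul_div_comm, one_mul]
        gcongr
      have h3 : (I.volume j / I.reserved lam μ j) ^ α ≤ (1 / (1 - μ) * x) ^ α :=
        Real.rpow_le_rpow (div_nonneg (I.volume_pos j).le (by rw [hres]; positivity)) h2
          (by linarith)
      refine (mul_le_mul_of_nonneg_left h3 (by rw [hres]; positivity)).trans_eq ?_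
      rw [Real.mul_rpow (by positivity) hx0.le, hres, Real.rpow_sub_one (by positivity)]
      field_simp
    -- Jensen's inequality from the tangent at the mean speed `x`, where the linear terms cancel.
    have h2 : T * x ^ α ≤ ∑ t ∈ Finset.Ico (I.release j) (I.deadline j), τ t j * s t ^ α := by
      have h3 : ∀ t ∈ Finset.Ico (I.release j) (I.deadline j),
          τ t j * x ^ α + α * x ^ (α - 1) * (τ t j * s t - τ t j * x) ≤ τ t j * s t ^ α := by
        intro t _
        have h4 := mul_le_mul_of_nonneg_left (rpow_tangent_le hx0.le (hs t) hα) (hτ0 t j)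
        linarith
      have h5 := Finset.sum_le_sum h3
      rw [Finset.sum_add_distrib, ← Finset.mul_sum, Finset.sum_sub_distrib, ← Finset.sum_mul,
        ← Finset.sum_mul, ← hT, ← hW, hx, mul_div_cancel₀ _ hTpos.ne', sub_self, mul_zero,
        add_zero] at h5
      exact h5
    have h3 : ∑ t ∈ Finset.Ico (I.release j) (I.deadline j), τ t j * s t ^ α ≤
        ∑ t ∈ C, τ t j * s t ^ α := by
      have hnn : ∀ t, 0 ≤ τ t j * s t ^ α := fun t =>
        mul_nonneg (hτ0 t j) (Real.rpow_nonneg (hs t) α)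
      calc _ ≤ ∑ t ∈ Finset.Ico (I.release j) (I.deadline j) ∪ C, τ t j * s t ^ α :=
            Finset.sum_le_sum_of_subset_of_nonneg Finset.subset_union_left fun t _ _ => hnn t
        _ = _ := by
            refine (Finset.sum_subset Finset.subset_union_right fun t _ ht => ?_).symm
            rw [hsdef, hY.eq_zero t ht, Real.zero_rpow (by linarith), mul_zero]
    exact h1.trans (mul_le_mul_of_nonneg_left (h2.trans h3) (by positivity))
  refine (Finset.sum_le_sum fun j _ => hjob j).trans ?_
  rw [← Finset.mul_sum, Finset.sum_comm]
  refine mul_le_mul_of_nonneg_left (Finset.sum_le_sum fun t _ => ?_) (by positivity)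
  rw [← Finset.sum_mul]
  exact mul_le_of_le_one_left (Real.rpow_nonneg (hs t) α) (hS.sum_le_one t)

end Instance

/-! ### The schedule -/

namespace Instance

variable {n : ℕ} {I : Instance n} {lam μ α : ℝ} {y : Fin n → ℤ → ℝ}

/-- The volume in the right part of slot `t` that EDF processes before `j`. -/
noncomputable def rightBefore (I : Instance n) (y : Fin n → ℤ → ℝ) (t : ℤ) (j : Fin n) : ℝ :=
  open Classical in ∑ i with I.Before i j, y i t

/-- The time in the left part of slot `t` at which SwP runs `j`. -/
def leftPiece (I : Instance n) (lam μ : ℝ) (t : ℤ) (j : Fin n) : Set ℝ :=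
  Set.Ico (t + (1 - μ) * (I.shrunk lam).ydsLo t j) (t + (1 - μ) * (I.shrunk lam).ydsHi t j)

/-- The time in the right part of slot `t` at which SwP runs `j`. -/
def rightPiece (I : Instance n) (μ : ℝ) (y : Fin n → ℤ → ℝ) (t : ℤ) (j : Fin n) : Set ℝ :=
  Set.Ico (t + (1 - μ) + I.rightBefore y t j / I.rightSpeed μ y t)
    (t + (1 - μ) + (I.rightBefore y t j + y j t) / I.rightSpeed μ y t)

namespace IsSwPAssignment

lemma rightSpeed_eq (hy : I.IsSwPAssignment lam μ y) (t : ℤ) :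
    I.rightSpeed μ y t = (∑ i, y i t) / μ := by
  rw [rightSpeed, Finset.sum_filter]
  congr 1
  refine Finset.sum_congr rfl fun i _ => ?_
  split_ifs with h
  · rfl
  · exact (hy.outside i t fun hc => h (Finset.mem_Ico.1 hc).1).symm

lemma rightSpeed_nonneg (hy : I.IsSwPAssignment lam μ y) (hμ : 0 ≤ μ) (t : ℤ) :
    0 ≤ I.rightSpeed μ y t := by
  rw [hy.rightSpeed_eq]
  exact div_nonneg (Finset.sum_nonneg fun i _ => hy.y_nonneg i t) hμ

lemma rightBefore_nonneg (hy : I.IsSwPAssignment lam μ y) (t : ℤ) (j : Fin n) :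
    0 ≤ I.rightBefore y t j :=
  Finset.sum_nonneg fun i _ => hy.y_nonneg i t

lemma rightBefore_add_le (hy : I.IsSwPAssignment lam μ y) (t : ℤ) (j : Fin n) :
    I.rightBefore y t j + y j t ≤ ∑ i, y i t := by
  classical
  have h : I.rightBefore y t j + y j t =
      ∑ i ∈ insert j (Finset.univ.filter fun i => I.Before i j), y i t := by
    rw [Finset.sum_insert (by simp [JobSet.before_iff]), add_comm, rightBefore]
  rw [h]
  exact Finset.sum_le_sum_of_subset_of_nonneg (Finset.subset_univ _)
    fun i _ _ => hy.y_nonneg i t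

lemma rightBefore_add_le_rightBefore (hy : I.IsSwPAssignment lam μ y) (t : ℤ) {i j : Fin n}
    (h : I.Before i j) : I.rightBefore y t i + y i t ≤ I.rightBefore y t j :=
  I.toJobSet.sum_before_add_le (b := fun i => y i t) (fun i => hy.y_nonneg i t) h

lemma rightBefore_add_div_le (hy : I.IsSwPAssignment lam μ y) (hμ : 0 ≤ μ) (t : ℤ)
    (j : Fin n) : (I.rightBefore y t j + y j t) / I.rightSpeed μ y t ≤ μ := by
  rcases (hy.rightSpeed_nonneg hμ t).eq_or_lt with h | h
  · rw [← h, div_zero]; exact hμ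
  rw [div_le_iff₀ h]
  refine (hy.rightBefore_add_le t j).trans_eq ?_
  rw [hy.rightSpeed_eq] at h ⊢
  rw [mul_div_cancel₀]
  rintro rfl
  simp at h

lemma leftPiece_subset (hS : (I.shrunk lam).SlotSpec) (hμ : μ ≤ 1) (t : ℤ) (j : Fin n) :
    I.leftPiece lam μ t j ⊆ Set.Ico (t : ℝ) (t + (1 - μ)) := by
  have h1 := hS.lo_nonneg t j
  have h2 := hS.hi_le_one t j
  refine Set.Ico_subset_Ico ?_ ?_ <;> nlinarith

lemma rightPiece_subset (hy : I.IsSwPAssignment lam μ y) (hμ : 0 ≤ μ) (t : ℤ) (j : Fin n) :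
    I.rightPiece μ y t j ⊆ Set.Ico (t + (1 - μ)) ((t : ℝ) + 1) := by
  have h1 := hy.rightBefore_add_div_le hμ t j
  have h2 := div_nonneg (hy.rightBefore_nonneg t j) (hy.rightSpeed_nonneg hμ t)
  refine Set.Ico_subset_Ico ?_ ?_ <;> linarith

lemma swpRuns_iff (hy : I.IsSwPAssignment lam μ y) (hS : (I.shrunk lam).SlotSpec) (hμ₀ : 0 ≤ μ)
    (hμ₁ : μ ≤ 1) (j : Fin n) (τ : ℝ) :
    I.SwPRuns lam μ y j τ ↔ ⌊τ⌋ ∈ Finset.Ico (I.release j) (I.deadline j) ∧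
      (τ ∈ I.leftPiece lam μ ⌊τ⌋ j ∨ τ ∈ I.rightPiece μ y ⌊τ⌋ j) := by
  have hτ : τ = ⌊τ⌋ + Int.fract τ := (Int.floor_add_fract τ).symm
  have hf1 := Int.fract_lt_one τ
  rw [SwPRuns, and_or_left]
  refine or_congr ?_ ?_
  · rw [Finset.mem_Ico, and_assoc, leftPiece, Set.mem_Ico]
    refine and_congr_right fun _ => and_congr_right fun _ => ?_
    constructor
    · rintro ⟨-, h1, h2⟩
      constructor <;> linarith
    · rintro ⟨h1, h2⟩
      have h3 := mul_le_of_le_one_right (by linarith : 0 ≤ 1 - μ) (hS.hi_le_one ⌊τ⌋ j)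
      refine ⟨?_, ?_, ?_⟩ <;> linarith
  · change 1 - μ ≤ Int.fract τ ∧ I.rightBefore y ⌊τ⌋ j ≤ _ ∧ _ < I.rightBefore y ⌊τ⌋ j + _ ↔ _
    rw [rightPiece, Set.mem_Ico]
    have hs := hy.rightSpeed_nonneg hμ₀ ⌊τ⌋
    constructor
    · rintro ⟨h1, h2, h3⟩
      -- The right-part condition does not mention the window; membership follows because `y`
      -- vanishes outside it.
      have hy0 : y j ⌊τ⌋ ≠ 0 := by intro hc; rw [hc] at h3; linarith
      refine ⟨by_contra fun hc => hy0 (hy.outside j _ hc), ?_⟩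
      have hspos : 0 < I.rightSpeed μ y ⌊τ⌋ := by
        have hμpos : 0 < μ := by linarith
        rw [hy.rightSpeed_eq]
        refine div_pos (lt_of_lt_of_le ?_
          (Finset.single_le_sum (fun i _ => hy.y_nonneg i ⌊τ⌋) (Finset.mem_univ j))) hμpos
        exact lt_of_le_of_ne (hy.y_nonneg j _) hy0.symm
      have h4 := (div_le_iff₀' hspos).2 h2
      have h5 := (lt_div_iff₀' hspos).2 h3
      constructor <;> linarith
    · rintro ⟨-, h1, h2⟩
      have hspos : 0 < I.rightSpeed μ y ⌊τ⌋ := by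
        refine lt_of_le_of_ne hs fun hc => ?_
        rw [← hc, div_zero] at h1
        rw [← hc, div_zero] at h2
        linarith
      have h3 := div_nonneg (hy.rightBefore_nonneg ⌊τ⌋ j) hs
      refine ⟨by linarith, (div_le_iff₀' hspos).1 (by linarith),
        (lt_div_iff₀' hspos).1 (by linarith)⟩

/-- This makes the choice in `swpJob` immaterial. Left intervals are separated by the EDF order of
the shrunk predicted jobs, right ones by that of the true jobs. -/
lemma swpRuns_unique (hy : I.IsSwPAssignment lam μ y) (hS : (I.shrunk lam).SlotSpec)
    (hμ₁ : μ ≤ 1) {i j : Fin n} {τ : ℝ} (hi : I.SwPRuns lam μ y i τ)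
    (hj : I.SwPRuns lam μ y j τ) : i = j := by
  by_contra hij
  rcases hi with ⟨-, -, h1, h2, h3⟩ | ⟨h1, h2, h3⟩ <;>
    rcases hj with ⟨-, -, h1', h2', h3'⟩ | ⟨h1', h2', h3'⟩
  · rcases JobSet.Before.trichotomy (I.shrunk lam) hij with h | h
    · have := mul_le_mul_of_nonneg_left (hS.ordered ⌊τ⌋ _ _ h) (by linarith : 0 ≤ 1 - μ)
      linarith
    · have := mul_le_mul_of_nonneg_left (hS.ordered ⌊τ⌋ _ _ h) (by linarith : 0 ≤ 1 - μ)
      linarith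
  · linarith
  · linarith
  · rcases JobSet.Before.trichotomy I.toJobSet hij with h | h
    · have := hy.rightBefore_add_le_rightBefore ⌊τ⌋ h
      exact absurd (h3.trans_le (this.trans h2')) (lt_irrefl _)
    · have := hy.rightBefore_add_le_rightBefore ⌊τ⌋ h
      exact absurd (h3'.trans_le (this.trans h2)) (lt_irrefl _)

lemma swpJob_eq_some_iff (hy : I.IsSwPAssignment lam μ y) (hS : (I.shrunk lam).SlotSpec)
    (hμ₁ : μ ≤ 1) {j : Fin n} {τ : ℝ} :
    I.swpJob lam μ y τ = some j ↔ I.SwPRuns lam μ y j τ := by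
  rw [swpJob]
  split_ifs with h
  · rw [Option.some_inj]
    exact ⟨fun hj => hj ▸ h.choose_spec,
      fun hj => hy.swpRuns_unique hS hμ₁ h.choose_spec hj⟩
  · exact ⟨fun hc => by simp at hc, fun hj => absurd ⟨j, hj⟩ h⟩

lemma setOf_swpJob (hy : I.IsSwPAssignment lam μ y) (hS : (I.shrunk lam).SlotSpec) (hμ₀ : 0 ≤ μ)
    (hμ₁ : μ ≤ 1) (j : Fin n) :
    {τ | I.swpJob lam μ y τ = some j} =
      ⋃ t ∈ Finset.Ico (I.release j) (I.deadline j),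
        (I.leftPiece lam μ t j ∪ I.rightPiece μ y t j) := by
  ext τ
  rw [Set.mem_ofPred_eq, hy.swpJob_eq_some_iff hS hμ₁, hy.swpRuns_iff hS hμ₀ hμ₁]
  simp only [Set.mem_iUnion₂]
  constructor
  · rintro ⟨h1, h2⟩
    exact ⟨_, h1, h2⟩
  · rintro ⟨t, ht, h⟩
    have hfl : ⌊τ⌋ = t := by
      rw [Int.floor_eq_iff]
      rcases h with h | h
      · have := leftPiece_subset hS hμ₁ t j h
        exact ⟨this.1, this.2.trans_le (by linarith)⟩
      · have := hy.rightPiece_subset hμ₀ t j h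
        exact ⟨le_trans (by linarith) this.1, this.2⟩
    rw [hfl]
    exact ⟨ht, h⟩

/-- Integration of a function of the speed over the time at which SwP runs `j`. -/
lemma lintegral_swpJob (hy : I.IsSwPAssignment lam μ y) (hS : (I.shrunk lam).SlotSpec)
    (hμ₀ : 0 ≤ μ) (hμ₁ : μ ≤ 1) (j : Fin n) (f : ℝ → ℝ≥0∞) :
    ∫⁻ τ in {τ | I.swpJob lam μ y τ = some j}, f ((I.swpSchedule lam μ y).speed τ) =
      ∑ t ∈ Finset.Ico (I.release j) (I.deadline j),
        (f (I.leftVolume y j / I.reserved lam μ j) *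
            ENNReal.ofReal ((1 - μ) * (I.shrunk lam).ydsHi t j -
              (1 - μ) * (I.shrunk lam).ydsLo t j) +
          f (I.rightSpeed μ y t) * ENNReal.ofReal (y j t / I.rightSpeed μ y t)) := by
  have hset := hy.setOf_swpJob hS hμ₀ hμ₁ j
  have hml : ∀ t, MeasurableSet (I.leftPiece lam μ t j) := fun t => measurableSet_Ico
  have hmr : ∀ t, MeasurableSet (I.rightPiece μ y t j) := fun t => measurableSet_Ico
  have hslot : ∀ t, I.leftPiece lam μ t j ∪ I.rightPiece μ y t j ⊆
      Set.Ico (t : ℝ) (t + 1) := by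
    intro t
    refine Set.union_subset ((leftPiece_subset hS hμ₁ t j).trans (Set.Ico_subset_Ico_right ?_))
      ((hy.rightPiece_subset hμ₀ t j).trans (Set.Ico_subset_Ico_left ?_)) <;> linarith
  rw [hset, lintegral_biUnion_finset
    (((Set.pairwise_disjoint_Ico_intCast ℝ).set_pairwise _).mono' fun s t hst =>
      hst.mono (hslot s) (hslot t))
    fun t _ => (hml t).union (hmr t)]
  refine Finset.sum_congr rfl fun t ht => ?_
  have hfl : ∀ τ ∈ I.leftPiece lam μ t j ∪ I.rightPiece μ y t j, ⌊τ⌋ = t := fun τ hτ =>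
    Int.floor_eq_iff.2 (hslot t hτ)
  have hjob : ∀ τ ∈ I.leftPiece lam μ t j ∪ I.rightPiece μ y t j,
      I.swpJob lam μ y τ = some j := by
    intro τ hτ
    have : τ ∈ {τ | I.swpJob lam μ y τ = some j} := by
      rw [hset]; exact Set.mem_biUnion ht hτ
    exact this
  have hdisj : Disjoint (I.leftPiece lam μ t j) (I.rightPiece μ y t j) := by
    refine Set.disjoint_left.2 fun τ h1 h2 => ?_
    exact absurd ((leftPiece_subset hS hμ₁ t j h1).2)
      (not_lt.2 (hy.rightPiece_subset hμ₀ t j h2).1)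
  have hleft : ∀ τ ∈ I.leftPiece lam μ t j, (I.swpSchedule lam μ y).speed τ =
      I.leftVolume y j / I.reserved lam μ j := by
    intro τ hτ
    have h1 := (leftPiece_subset hS hμ₁ t j hτ).2
    have h2 : Int.fract τ < 1 - μ := by
      rw [Int.fract, hfl τ (Or.inl hτ)]; linarith
    simp only [swpSchedule, hjob τ (Or.inl hτ), if_pos h2]
  have hright : ∀ τ ∈ I.rightPiece μ y t j, (I.swpSchedule lam μ y).speed τ =
      I.rightSpeed μ y t := by
    intro τ hτ
    have h1 := (hy.rightPiece_subset hμ₀ t j hτ).1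
    have h2 : ¬ Int.fract τ < 1 - μ := by
      rw [Int.fract, hfl τ (Or.inr hτ)]; linarith
    simp only [swpSchedule, hjob τ (Or.inr hτ), if_neg h2, hfl τ (Or.inr hτ)]
  rw [lintegral_union (hmr t) hdisj]
  congr 1
  · rw [setLIntegral_congr_fun (g := fun _ => f (I.leftVolume y j / I.reserved lam μ j))
      (hml t) fun τ hτ => by simp only [hleft τ hτ], setLIntegral_const, leftPiece,
      Real.volume_Ico]
    congr 2
    ring
  · rw [setLIntegral_congr_fun (g := fun _ => f (I.rightSpeed μ y t))
      (hmr t) fun τ hτ => by simp only [hright τ hτ], setLIntegral_const, rightPiece,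
      Real.volume_Ico]
    congr 2
    ring

lemma measurableSet_swpJob (hy : I.IsSwPAssignment lam μ y) (hS : (I.shrunk lam).SlotSpec)
    (hμ₀ : 0 ≤ μ) (hμ₁ : μ ≤ 1) (j : Fin n) :
    MeasurableSet {τ | I.swpJob lam μ y τ = some j} := by
  rw [hy.setOf_swpJob hS hμ₀ hμ₁ j]
  exact Finset.measurableSet_biUnion _ fun t _ => measurableSet_Ico.union measurableSet_Ico

lemma measurable_speed (hy : I.IsSwPAssignment lam μ y) (hS : (I.shrunk lam).SlotSpec)
    (hμ₀ : 0 ≤ μ) (hμ₁ : μ ≤ 1) : Measurable (I.swpSchedule lam μ y).speed := by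
  classical
  have heq : (I.swpSchedule lam μ y).speed = fun τ => ∑ j,
      {τ | I.swpJob lam μ y τ = some j}.indicator (fun τ =>
        if Int.fract τ < 1 - μ then I.leftVolume y j / I.reserved lam μ j
        else I.rightSpeed μ y ⌊τ⌋) τ := by
    funext τ
    rcases h : I.swpJob lam μ y τ with _ | j
    · simp [swpSchedule, h]
    · simp [swpSchedule, h, Set.indicator, Finset.sum_ite_eq]
  rw [heq]
  refine Finset.measurable_sum _ fun j _ => Measurable.indicator ?_
    (hy.measurableSet_swpJob hS hμ₀ hμ₁ j)
  have hlt : MeasurableSet {τ : ℝ | Int.fract τ < 1 - μ} :=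
    measurableSet_lt measurable_fract measurable_const
  refine Measurable.ite hlt measurable_const ?_
  exact (measurable_of_countable fun t : ℤ => I.rightSpeed μ y t).comp
    (Int.measurable_floor (R := ℝ))

lemma speed_nonneg (hy : I.IsSwPAssignment lam μ y) (hl : ∀ j, 0 ≤ I.reserved lam μ j)
    (hμ₀ : 0 ≤ μ) (τ : ℝ) : 0 ≤ (I.swpSchedule lam μ y).speed τ := by
  simp only [swpSchedule]
  split
  · exact le_rfl
  · split_ifs
    · exact div_nonneg (hy.leftVolume_nonneg _) (hl _)
    · exact hy.rightSpeed_nonneg hμ₀ _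

lemma isFeasible (hy : I.IsSwPAssignment lam μ y) (hS : (I.shrunk lam).SlotSpec)
    (hμ₀ : 0 ≤ μ) (hμ₁ : μ ≤ 1) (hpos : 0 < μ ∨ ∀ j, 0 < I.reserved lam μ j) :
    (I.swpSchedule lam μ y).IsFeasible I.toJobSet := by
  have hl := reserved_nonneg (I := I) hS hμ₁
  refine ⟨hy.measurable_speed hS hμ₀ hμ₁, hy.measurableSet_swpJob hS hμ₀ hμ₁,
    hy.speed_nonneg hl hμ₀, fun τ j h => ?_, fun j => ?_⟩
  · have h1 := ((hy.swpRuns_iff hS hμ₀ hμ₁ j τ).1 ((hy.swpJob_eq_some_iff hS hμ₁).1 h)).1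
    rw [Finset.mem_Ico, Int.le_floor, Int.floor_lt] at h1
    exact h1
  · refine le_of_le_of_eq ?_ (hy.lintegral_swpJob hS hμ₀ hμ₁ j ENNReal.ofReal).symm
    have hσ0 : 0 ≤ I.leftVolume y j / I.reserved lam μ j :=
      div_nonneg (hy.leftVolume_nonneg j) (hl j)
    -- A right part of speed zero carries no volume: for $\mu>0$ because its load is zero, for
    -- $\mu=0$ because positive reservations keep all volume on the left.
    have hright : ∀ t, I.rightSpeed μ y t * (y j t / I.rightSpeed μ y t) = y j t := by
      intro t
      refine mul_div_cancel_of_imp' fun h => ?_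
      rcases hμ₀.eq_or_lt with rfl | hμ
      · exact hy.eq_zero_of_mu_eq_zero (hpos.resolve_left (lt_irrefl _) j) t
      · rw [hy.rightSpeed_eq, div_eq_zero_iff, or_iff_left hμ.ne'] at h
        exact (Finset.sum_eq_zero_iff_of_nonneg fun i _ => hy.y_nonneg i t).1 h j
          (Finset.mem_univ j)
    have hleft : I.leftVolume y j / I.reserved lam μ j * I.reserved lam μ j =
        I.leftVolume y j := by
      refine div_mul_cancel_of_imp fun h => ?_
      exact hy.leftVolume_eq_zero (hpos.resolve_right fun hc => (hc j).ne' h) h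
    have hlo : ∀ t, 0 ≤ (1 - μ) * (I.shrunk lam).ydsHi t j -
        (1 - μ) * (I.shrunk lam).ydsLo t j := fun t =>
      sub_nonneg.2 (mul_le_mul_of_nonneg_left (hS.lo_le_hi t j) (by linarith))
    have hterm : ∀ t, ENNReal.ofReal (I.leftVolume y j / I.reserved lam μ j) *
            ENNReal.ofReal ((1 - μ) * (I.shrunk lam).ydsHi t j -
              (1 - μ) * (I.shrunk lam).ydsLo t j) +
          ENNReal.ofReal (I.rightSpeed μ y t) * ENNReal.ofReal (y j t / I.rightSpeed μ y t) =
        ENNReal.ofReal (I.leftVolume y j / I.reserved lam μ j *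
          ((1 - μ) * (I.shrunk lam).ydsHi t j - (1 - μ) * (I.shrunk lam).ydsLo t j) +
            y j t) := by
      intro t
      rw [← ENNReal.ofReal_mul hσ0, ← ENNReal.ofReal_mul (hy.rightSpeed_nonneg hμ₀ t), hright,
        ENNReal.ofReal_add (mul_nonneg hσ0 (hlo t)) (hy.y_nonneg j t)]
    simp only [hterm]
    rw [← ENNReal.ofReal_sum_of_nonneg fun t _ =>
      add_nonneg (mul_nonneg hσ0 (hlo t)) (hy.y_nonneg j t), Finset.sum_add_distrib,
      ← Finset.mul_sum, ← reserved, hleft, leftVolume, sub_add_cancel]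

lemma energy_eq (hy : I.IsSwPAssignment lam μ y) (hS : (I.shrunk lam).SlotSpec)
    (hμ₀ : 0 ≤ μ) (hμ₁ : μ ≤ 1) (hα : 1 < α) {L N : ℤ}
    (hLN : ∀ j, L ≤ I.release j ∧ I.deadline j ≤ N) :
    (I.swpSchedule lam μ y).energy α = ENNReal.ofReal (cost I lam μ α y L N) := by
  have hl := reserved_nonneg (I := I) hS hμ₁
  have hmeas := hy.measurableSet_swpJob hS hμ₀ hμ₁
  have hα0 : α ≠ 0 := by linarith
  have h1 : (I.swpSchedule lam μ y).energy α =
      ∑ j, ∫⁻ τ in {τ | I.swpJob lam μ y τ = some j},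
        ENNReal.ofReal ((I.swpSchedule lam μ y).speed τ ^ α) := by
    rw [Schedule.energy, ← lintegral_add_compl _ (MeasurableSet.iUnion hmeas),
      lintegral_iUnion hmeas (Schedule.IsFeasible.disjoint_running (I.swpSchedule lam μ y)),
      tsum_fintype, setLIntegral_congr_fun (g := fun _ => 0) (MeasurableSet.iUnion hmeas).compl,
      lintegral_zero, add_zero]
    intro τ hτ
    have h2 : I.swpJob lam μ y τ = none := by
      rcases h : I.swpJob lam μ y τ with _ | j
      · rfl
      · exact absurd (Set.mem_iUnion.2 ⟨j, h⟩) hτ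
    simp only [swpSchedule, h2, Real.zero_rpow hα0, ENNReal.ofReal_zero]
  have hσ0 : ∀ j, 0 ≤ (I.leftVolume y j / I.reserved lam μ j) ^ α := fun j =>
    Real.rpow_nonneg (div_nonneg (hy.leftVolume_nonneg j) (hl j)) _
  have hs0 := hy.rightSpeed_nonneg hμ₀
  have hlo : ∀ t j, 0 ≤ (1 - μ) * (I.shrunk lam).ydsHi t j -
      (1 - μ) * (I.shrunk lam).ydsLo t j := fun t j =>
    sub_nonneg.2 (mul_le_mul_of_nonneg_left (hS.lo_le_hi t j) (by linarith))
  have hr0 : ∀ t j, 0 ≤ I.rightSpeed μ y t ^ α * (y j t / I.rightSpeed μ y t) := fun t j =>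
    mul_nonneg (Real.rpow_nonneg (hs0 t) _) (div_nonneg (hy.y_nonneg j t) (hs0 t))
  have h2 : ∀ j, ∫⁻ τ in {τ | I.swpJob lam μ y τ = some j},
        ENNReal.ofReal ((I.swpSchedule lam μ y).speed τ ^ α) =
      ENNReal.ofReal (I.reserved lam μ j * (I.leftVolume y j / I.reserved lam μ j) ^ α +
        ∑ t ∈ Finset.Ico L N, I.rightSpeed μ y t ^ α * (y j t / I.rightSpeed μ y t)) := by
    intro j
    rw [hy.lintegral_swpJob hS hμ₀ hμ₁ j fun s => ENNReal.ofReal (s ^ α)]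
    simp only [← ENNReal.ofReal_mul (hσ0 j), ← ENNReal.ofReal_mul (Real.rpow_nonneg (hs0 _) α)]
    simp only [← ENNReal.ofReal_add (mul_nonneg (hσ0 j) (hlo _ j)) (hr0 _ j)]
    rw [← ENNReal.ofReal_sum_of_nonneg fun t _ =>
      add_nonneg (mul_nonneg (hσ0 j) (hlo t j)) (hr0 t j), Finset.sum_add_distrib,
      ← Finset.mul_sum, ← reserved, mul_comm (_ ^ α)]
    congr 2
    refine Finset.sum_subset (Finset.Ico_subset_Ico (hLN j).1 (hLN j).2) fun t _ ht => ?_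
    rw [hy.outside j t ht, zero_div, mul_zero]
  rw [h1, Finset.sum_congr rfl fun j _ => h2 j, ← ENNReal.ofReal_sum_of_nonneg fun j _ =>
    add_nonneg (mul_nonneg (hl j) (hσ0 j)) (Finset.sum_nonneg fun t _ => hr0 t j),
    Finset.sum_add_distrib, Finset.sum_comm, cost]
  congr 2
  refine Finset.sum_congr rfl fun t _ => ?_
  -- The running times in a right part add up to its load divided by its speed, which is $\mu$
  -- unless the speed is zero.
  rw [← Finset.mul_sum, ← Finset.sum_div, hy.rightSpeed_eq]
  by_cases h : (∑ i, y i t) / μ = 0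
  · rw [h, Real.zero_rpow hα0, zero_mul, mul_zero]
  · have h3 : (∑ i, y i t) ≠ 0 ∧ μ ≠ 0 := by
      constructor <;> rintro hc <;> simp [hc] at h
    rw [div_div_cancel₀ h3.1, mul_comm]

end IsSwPAssignment

end Instance

/-! ### Comparison with the optimum. -/

lemma JobSet.le_mul_optEnergy {n : ℕ} {J : JobSet n} {α c : ℝ} (hc : 0 < c) {E : ℝ≥0∞}
    (h : ∀ S : Schedule n, S.IsFeasible J → E ≤ ENNReal.ofReal c * S.energy α) :
    E ≤ ENNReal.ofReal c * J.optEnergy α := by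
  have hc0 : ENNReal.ofReal c ≠ 0 := by simpa using hc
  rw [mul_comm, ← ENNReal.div_le_iff_le_mul (Or.inl hc0) (Or.inl ENNReal.ofReal_ne_top)]
  refine le_iInf₂ fun S hS => ?_
  rw [ENNReal.div_le_iff_le_mul (Or.inl hc0) (Or.inl ENNReal.ofReal_ne_top), mul_comm]
  exact h S hS

namespace Instance.IsSwPAssignment

variable {n : ℕ} {I : Instance n} {lam μ α : ℝ} {y : Fin n → ℤ → ℝ}

lemma energy_le_robust (hy : I.IsSwPAssignment lam μ y) (hS : (I.shrunk lam).SlotSpec)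
    (hμ₀ : 0 < μ) (hμ₁ : μ ≤ 1) (hα : 1 < α) :
    (I.swpSchedule lam μ y).energy α ≤
      ENNReal.ofReal (2 ^ (α - 1) * α ^ α * (1 / μ) ^ (α - 1)) * I.optEnergy α := by
  obtain ⟨L, N, hLN⟩ := exists_cover I.toJobSet
  refine JobSet.le_mul_optEnergy (by positivity) fun S hfeas => ?_
  rw [hy.energy_eq hS hμ₀.le hμ₁ hα hLN]
  refine (ENNReal.ofReal_le_ofReal
    (hy.cost_le_avr hμ₀ hα (reserved_nonneg hS hμ₁) hLN)).trans ?_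
  rw [ENNReal.ofReal_mul (by positivity), mul_comm (2 ^ (α - 1) * α ^ α),
    ENNReal.ofReal_mul (by positivity) (q := 2 ^ (α - 1) * α ^ α), mul_assoc]
  gcongr
  exact JobSet.avr_le_energy I.valid hα hfeas hLN

lemma energy_le_consistent (hy : I.IsSwPAssignment lam μ y) (hS : (I.shrunk lam).SlotSpec)
    {v : Fin n → ℝ} {C : Finset ℤ} (hY : (I.shrunk lam).YDSSpec v C) (hlam₀ : 0 ≤ lam)
    (hlam₁ : lam < 1 / 2) (hμ₀ : 0 ≤ μ) (hμ₁ : μ < 1) (hα : 1 < α) (h : I.predError ≤ lam) :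
    (I.swpSchedule lam μ y).energy α ≤
      ENNReal.ofReal ((1 / (1 - μ)) ^ (α - 1) *
        ((2 * I.predError + 1) / (1 - 2 * lam)) ^ (α - 1)) * I.optEnergy α := by
  obtain ⟨L, N, hLN⟩ := exists_cover I.toJobSet
  have hη := I.predError_nonneg
  have h1 : 0 < 1 - μ := by linarith
  have h2 : 0 < 1 - 2 * lam := by linarith
  refine JobSet.le_mul_optEnergy (by positivity) fun S hfeas => ?_
  rw [hy.energy_eq hS hμ₀ hμ₁.le hα hLN]
  refine (ENNReal.ofReal_le_ofReal
    ((hy.cost_le_reserved hμ₀ hα (reserved_pos hS hY.speed_nonneg h hμ₁) hLN).trans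
      (sum_reserved_le_yds hY hS h hμ₁ hα))).trans ?_
  rw [ENNReal.ofReal_mul (by positivity), ENNReal.ofReal_mul (by positivity), mul_assoc]
  gcongr
  have h3 : (2 * I.predError + 1) / (1 - 2 * lam) =
      1 + 2 * ((lam + I.predError) / (1 - 2 * lam)) := by
    field_simp; ring
  rw [h3]
  exact JobSet.yds_le_energy I.valid (I.shrunk_valid hlam₁) rfl hY (by positivity)
    (fun j => (I.window_subset_dilation hlam₀ hlam₁ j).1)
    (fun j => (I.window_subset_dilation hlam₀ hlam₁ j).2) hα hfeas

end Instance.IsSwPAssignment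

end SpeedScaling

theorem theorem1 {n : ℕ} (I : SpeedScaling.Instance n) (α lam μ : ℝ) (hα : 1 < α)
    (hlam₀ : 0 ≤ lam) (hlam₁ : lam < 1 / 2) (hμ₀ : 0 ≤ μ) (hμ₁ : μ ≤ 1) :
    (∃ S, I.IsSwPSchedule lam μ S) ∧
    ∀ S, I.IsSwPSchedule lam μ S →
      (0 < μ ∨ I.predError ≤ lam → S.IsFeasible I.toJobSet) ∧
      (0 < μ → S.energy α ≤
        ENNReal.ofReal (2 ^ (α - 1) * α ^ α * (1 / μ) ^ (α - 1)) * I.optEnergy α) ∧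
      (μ < 1 → I.predError ≤ lam → S.energy α ≤
        ENNReal.ofReal ((1 / (1 - μ)) ^ (α - 1) *
          ((2 * I.predError + 1) / (1 - 2 * lam)) ^ (α - 1)) * I.optEnergy α) ∧
      (0 < μ → μ < 1 → I.predError ≤ lam → S.energy α ≤
        ENNReal.ofReal (min
          ((1 / (1 - μ)) ^ (α - 1) * ((2 * I.predError + 1) / (1 - 2 * lam)) ^ (α - 1))
          (2 ^ (α - 1) * α ^ α * (1 / μ) ^ (α - 1))) * I.optEnergy α) := by
  have hJ := I.shrunk_valid hlam₁
  obtain ⟨v, C, hY⟩ := SpeedScaling.JobSet.exists_ydsSpec hJ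
  have hS := hY.slotSpec hJ
  refine ⟨?_, ?_⟩
  · obtain ⟨y, hy⟩ := SpeedScaling.Instance.exists_assignment (I := I)
      (SpeedScaling.Instance.reserved_nonneg hS hμ₁)
    exact ⟨_, y, hy, rfl⟩
  rintro S ⟨y, hy, rfl⟩
  have hrob : 0 < μ → _ := fun hμ => hy.energy_le_robust hS hμ hμ₁ hα
  have hcon : μ < 1 → I.predError ≤ lam → _ := fun hμ h =>
    hy.energy_le_consistent hS hY hlam₀ hlam₁ hμ₀ hμ hα h
  refine ⟨fun h => ?_, hrob, hcon, fun h1 h2 h3 => ?_⟩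
  · refine hy.isFeasible hS hμ₀ hμ₁ ?_
    -- Without right parts every job needs reserved time in its true window, which accurate
    -- predictions guarantee. For $\mu>0$ a job without reservation is processed entirely on the
    -- right.
    rcases hμ₀.eq_or_lt with rfl | hμ
    · exact Or.inr (SpeedScaling.Instance.reserved_pos hS hY.speed_nonneg
        (h.resolve_left (lt_irrefl _)) one_pos)
    · exact Or.inl hμ
  · rcases min_choice
      ((1 / (1 - μ)) ^ (α - 1) * ((2 * I.predError + 1) / (1 - 2 * lam)) ^ (α - 1))
      (2 ^ (α - 1) * α ^ α * (1 / μ) ^ (α - 1)) with h | h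
    · rw [h]; exact hcon h2 h3
    · rw [h]; exact hrob h1
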